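/- **Definitions.** Distances and time separations take values in $[0,\infty]$; $\inf\emptyset=\infty$, $\sup\emptyset=0$. A *Lorentzian pre-length space* is a tuple $(X,d,\ll,\le,\tau)$ where $d$ is a metric, $\le$ is a reflexive transitive relation, $\ll$ is a transitive relation contained in $\le$, and $\tau:X\times X\to[0,\infty]$ is lower semicontinuous with $\tau(x,z)\ge\tau(x,y)+\tau(y,z)$ whenever $x\le y\le z$, and $\tau(x,y)>0\iff x\ll y$. Put $I^+(x)=\{y: x\ll y\}$, $I^-(x)=\{y:y\ll x\}$, $I(x,y)=I^+(x)\cap I^-(y)$. A *causal* (resp. *timelike*) curve is a locally Lipschitz map $\gamma:[a,b]\to X$, $a<b$, with $\gamma(s)\le\gamma(t)$ (resp. $\gamma(s)\ll\gamma(t)$) for all $s<t$; constant curves are allowed as causal curves. Its $\tau$-length $L_\tau(\gamma)$ is the infimum of $\sum_i\tau(\gamma(t_i),\gamma(t_{i+1}))$ over all partitions of $[a,b]$, and $L_d(\gamma)$ is its metric length. A neighbourhood $U$ of a point is *localizable* if (i) there is $C>0$ with $L_d(\gamma)\le C$ for all causal curves $\gamma$ in $U$; (ii) there is a continuous $\omega:U\times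 U\to[0,\infty)$ such that $(U,d|_{U\times U},\ll|_{U\times U},\le|_{U\times U},\omega)$ is a Lorentzian pre-length space, and $I^\pm(p)\cap U\neq\emptyset$ for all $p\in U$; (iii) for all $p\le q$ in $U$ there is a causal curve $\gamma$ in $U$ from $p$ to $q$ which has maximal $\tau$-length among such curves and satisfies $L_\tau(\gamma)=\omega(p,q)$. $X$ is *localizable* if every point has a localizable neighbourhood, and *strongly localizable* if every point has a neighbourhood basis of localizable neighbourhoods. $X$ is *causally path-connected* if $x\ll y$ (resp. $x\le y$) implies that there is a timelike (resp. causal) curve from $x$ to $y$; *locally causally closed* if every point has a neighbourhood $U$ such that $\le$ restricted to $\overline U\times\overline U$ is closed; *intrinsic* if $\tau(x,y)=\sup\{L_\tau(\gamma):\gamma\text{ a causal curve from }x\text{ to }y\}$ for all $x,y$; *strongly causal* if the sets $I(x,y)$ form a subbasis of the metric topology. A *Lorentzian length space* is a locally causally closed, causally path-connected, localizable and intrinsic Lorentzian pre-length space. **Amalgamation.** Let $X_1,X_2$ be Lorentzian pre-length spaces and $A_i\subseteq X_i$ closed and *non-timelike locally isolating*: for every $a\in A_i$ with $I^+(a)\ne\emptyset$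 (resp. $I^-(a)\neq\emptyset$) and every neighbourhood $U$ of $a$ there is $b\in U\cap A_i$ with $a\ll b$ (resp. $b\ll a$). Let $f:A_1\to A_2$ be a locally bi-Lipschitz homeomorphism such that, for all $a,b\in A_1$, $I^\pm(a)\neq\emptyset\iff I^\pm(f(a))\ne\emptyset$, $\tau_1(a,b)=\tau_2(f(a),f(b))$, and $a\le_1 b\iff f(a)\le_2 f(b)$. On $X_1\sqcup X_2$ use the disjoint unions of the relations and the functions $d,\tau$ that extend $d_i,\tau_i$ by $d=\infty$, $\tau=0$ on pairs of points of different spaces. Let $\sim$ be the equivalence relation generated by $a\sim f(a)$, $a\in A_1$. The *Lorentzian amalgamation* $X_1\sqcup_A X_2$ is $(X_1\sqcup X_2)/{\sim}$ with $$\tilde d([x],[y])=\inf\Big\{\sum_{i=1}^n d(x_i,y_i): x\sim x_1,\ y_i\sim x_{i+1},\ y_n\sim y,\ n\ge1\Big\},$$ $$\tilde\tau([x],[y])=\sup\Big\{\sum_{i=1}^n\tau(x_i,y_i): x\sim x_1\le y_1\sim x_2\le y_2\sim\dots\sim x_n\le y_n\sim y,\ n\ge1\Big\},$$ $[x]\mathrel{\tilde\le}[y]$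 if a chain as in the definition of $\tilde\tau$ exists, and $[x]\mathrel{\tilde\ll}[y]$ if $\tilde\tau([x],[y])>0$. **Theorem (Amalgamation of length spaces).** Let $X_1$ and $X_2$ be strongly causal, locally compact Lorentzian length spaces, and let $X_1\sqcup_A X_2$ be their Lorentzian amalgamation along $f:A_1\to A_2$ as above. Then $X_1\sqcup_A X_2$ is a Lorentzian length space (in particular, $\tilde d$ is a metric), and it is strongly localizable. -/

import Mathlib

open scoped ENNReal NNReal Topology

/-- The data `(≪, ≤, τ)` of a Lorentzian pre-length space. The distance `d` is the `edist` of a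
(pseudo-)extended metric on `X`; distances and time separations take values in `[0, ∞]`. -/
structure LorentzianStructure (X : Type*) where
  /-- the timelike relation `≪` -/
  chron : X → X → Prop
  /-- the causal relation `≤` -/
  causal : X → X → Prop
  /-- the time separation `τ` -/
  tau : X → X → ℝ≥0∞

namespace LorentzianStructure

section Basic

variable {X : Type*} [PseudoEMetricSpace X] (S : LorentzianStructure X)

/-- `(X, d, ≪, ≤, τ)` is a Lorentzian pre-length space. The first field says that `d` separates
points, so that `d` is a genuine metric (with values in `[0, ∞]`). -/
structure IsPreLengthSpace : Prop where
  eq_of_edist_eq_zero : ∀ x y : X, edist x y = 0 → x = y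
  causal_refl : ∀ x, S.causal x x
  causal_trans : ∀ x y z, S.causal x y → S.causal y z → S.causal x z
  chron_trans : ∀ x y z, S.chron x y → S.chron y z → S.chron x z
  causal_of_chron : ∀ x y, S.chron x y → S.causal x y
  lowerSemicontinuous_tau : LowerSemicontinuous fun p : X × X => S.tau p.1 p.2
  tau_add_le : ∀ x y z, S.causal x y → S.causal y z → S.tau x y + S.tau y z ≤ S.tau x z
  tau_pos_iff : ∀ x y, 0 < S.tau x y ↔ S.chron x y

/-- The chronological future `I⁺(x)`. -/
def chronFuture (x : X) : Set X := {y | S.chron x y}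

/-- The chronological past `I⁻(x)`. -/
def chronPast (x : X) : Set X := {y | S.chron y x}

/-- The timelike diamond `I(x, y) = I⁺(x) ∩ I⁻(y)`. -/
def diamond (x y : X) : Set X := S.chronFuture x ∩ S.chronPast y

/-- `γ : [a, b] → X` is a (future-directed) causal curve. Only the values of `γ` on `[a, b]`
matter. -/
structure IsCausalCurve (a b : ℝ) (γ : ℝ → X) : Prop where
  lt : a < b
  locallyLipschitz : LocallyLipschitzOn (Set.Icc a b) γ
  causal : ∀ s ∈ Set.Icc a b, ∀ t ∈ Set.Icc a b, s < t → S.causal (γ s) (γ t)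

/-- `γ : [a, b] → X` is a (future-directed) timelike curve. -/
structure IsTimelikeCurve (a b : ℝ) (γ : ℝ → X) : Prop where
  lt : a < b
  locallyLipschitz : LocallyLipschitzOn (Set.Icc a b) γ
  chron : ∀ s ∈ Set.Icc a b, ∀ t ∈ Set.Icc a b, s < t → S.chron (γ s) (γ t)

/-- `t 0 < t 1 < ⋯ < t n` is a partition of `[a, b]`. -/
structure IsPartition (a b : ℝ) (n : ℕ) (t : ℕ → ℝ) : Prop where
  start : t 0 = a
  finish : t n = b
  lt : ∀ i < n, t i < t (i + 1)

/-- The `τ`-length `L_τ(γ)` of a curve `γ : [a, b] → X`: the infimum over all partitions. -/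
noncomputable def tauLength (a b : ℝ) (γ : ℝ → X) : ℝ≥0∞ :=
  ⨅ (n : ℕ) (t : ℕ → ℝ) (_ : IsPartition a b n t),
    ∑ i ∈ Finset.range n, S.tau (γ (t i)) (γ (t (i + 1)))

/-- `γ : [a, b] → X` is a causal curve from `x` to `y` that is contained in `U`. -/
structure IsCausalCurveFromToIn (U : Set X) (x y : X) (a b : ℝ) (γ : ℝ → X) : Prop
    extends S.IsCausalCurve a b γ where
  source : γ a = x
  target : γ b = y
  mapsTo : Set.MapsTo γ (Set.Icc a b) U

/-- The relations of `X` restricted to `U`, with a given function `ω` on `U × U` in place of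
the time separation. -/
def restrictWith (U : Set X) (ω : U × U → ℝ≥0) : LorentzianStructure U where
  chron p q := S.chron p q
  causal p q := S.causal p q
  tau p q := ω (p, q)

/-- The conditions on a neighbourhood `U` (of some point) to be a localizable neighbourhood.
Here `eVariationOn γ [a, b]` is the `d`-length of `γ : [a, b] → X`. -/
structure IsLocalizableSet (U : Set X) : Prop where
  exists_length_bound : ∃ C : ℝ≥0, ∀ (a b : ℝ) (γ : ℝ → X), S.IsCausalCurve a b γ →
    Set.MapsTo γ (Set.Icc a b) U → eVariationOn γ (Set.Icc a b) ≤ C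
  exists_omega : ∃ ω : U × U → ℝ≥0, Continuous ω ∧ (S.restrictWith U ω).IsPreLengthSpace ∧
    (∀ p ∈ U, (S.chronFuture p ∩ U).Nonempty ∧ (S.chronPast p ∩ U).Nonempty) ∧
    ∀ p q : U, S.causal p q → ∃ (a b : ℝ) (γ : ℝ → X), S.IsCausalCurveFromToIn U p q a b γ ∧
      (∀ (a' b' : ℝ) (σ : ℝ → X), S.IsCausalCurveFromToIn U p q a' b' σ →
        S.tauLength a' b' σ ≤ S.tauLength a b γ) ∧
      S.tauLength a b γ = ω (p, q)

/-- Every point has a localizable neighbourhood. -/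
def Localizable : Prop := ∀ x : X, ∃ U ∈ 𝓝 x, S.IsLocalizableSet U

/-- Every point has a neighbourhood basis of localizable neighbourhoods. -/
def StronglyLocalizable : Prop :=
  ∀ x : X, ∀ V ∈ 𝓝 x, ∃ U ∈ 𝓝 x, U ⊆ V ∧ S.IsLocalizableSet U

/-- Timelike related points are joined by timelike curves, causally related points by causal
curves. -/
def CausallyPathConnected : Prop :=
  (∀ x y : X, S.chron x y →
    ∃ (a b : ℝ) (γ : ℝ → X), S.IsTimelikeCurve a b γ ∧ γ a = x ∧ γ b = y) ∧
  ∀ x y : X, S.causal x y →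
    ∃ (a b : ℝ) (γ : ℝ → X), S.IsCausalCurve a b γ ∧ γ a = x ∧ γ b = y

/-- The restriction of `≤` to `closure U × closure U` is closed. -/
def CausallyClosed (U : Set X) : Prop :=
  IsClosed {p : closure U × closure U | S.causal p.1 p.2}

/-- Every point has a causally closed neighbourhood. -/
def LocallyCausallyClosed : Prop := ∀ x : X, ∃ U ∈ 𝓝 x, S.CausallyClosed U

/-- `𝒯(x, y)`: the supremum of the `τ`-lengths of the causal curves from `x` to `y`
(`0` if there are none). -/
noncomputable def curveTau (x y : X) : ℝ≥0∞ :=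
  ⨆ (a : ℝ) (b : ℝ) (γ : ℝ → X) (_ : S.IsCausalCurve a b γ ∧ γ a = x ∧ γ b = y),
    S.tauLength a b γ

/-- `τ = 𝒯`. -/
def Intrinsic : Prop := ∀ x y : X, S.tau x y = S.curveTau x y

/-- Lorentzian length spaces. -/
structure IsLengthSpace : Prop extends S.IsPreLengthSpace where
  locallyCausallyClosed : S.LocallyCausallyClosed
  causallyPathConnected : S.CausallyPathConnected
  localizable : S.Localizable
  intrinsic : S.Intrinsic

/-- The timelike diamonds form a subbasis of the metric topology. -/
def StronglyCausal : Prop :=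
  (UniformSpace.toTopologicalSpace : TopologicalSpace X) =
    TopologicalSpace.generateFrom {I | ∃ x y : X, I = S.diamond x y}

/-- `A` is non-timelike locally isolating, i.e. both non-future and non-past locally isolating. -/
def NonTimelikeLocallyIsolating (A : Set X) : Prop :=
  (∀ a ∈ A, (S.chronFuture a).Nonempty → ∀ U ∈ 𝓝 a, ∃ b ∈ U ∩ A, S.chron a b) ∧
  ∀ a ∈ A, (S.chronPast a).Nonempty → ∀ U ∈ 𝓝 a, ∃ b ∈ U ∩ A, S.chron b a

end Basic

end LorentzianStructure

/-! ### Disjoint unions -/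

/-- The disjoint union of two spaces, to be equipped with the disjoint union metric. -/
def DisjUnion (X₁ X₂ : Type*) := X₁ ⊕ X₂

namespace DisjUnion

variable {X₁ X₂ : Type*} [PseudoEMetricSpace X₁] [PseudoEMetricSpace X₂]

/-- The disjoint union metric: points of different spaces have distance `∞`. -/
noncomputable def dist : X₁ ⊕ X₂ → X₁ ⊕ X₂ → ℝ≥0∞
  | .inl x, .inl y => edist x y
  | .inr x, .inr y => edist x y
  | _, _ => ∞

noncomputable instance : PseudoEMetricSpace (DisjUnion X₁ X₂) where
  edist := DisjUnion.dist
  edist_self x := by rcases x with x | x <;> simp [DisjUnion.dist]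
  edist_comm x y := by
    rcases x with x | x <;> rcases y with y | y <;> simp [DisjUnion.dist, edist_comm]
  edist_triangle x y z := by
    rcases x with x | x <;> rcases y with y | y <;> rcases z with z | z <;>
      simp [DisjUnion.dist, edist_triangle]

end DisjUnion

namespace LorentzianStructure

/-- The Lorentzian structure on the disjoint union. -/
def disjUnion {X₁ X₂ : Type*} (S₁ : LorentzianStructure X₁) (S₂ : LorentzianStructure X₂) :
    LorentzianStructure (DisjUnion X₁ X₂) where
  chron := Sum.LiftRel S₁.chron S₂.chron
  causal := Sum.LiftRel S₁.causal S₂.causal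
  tau
    | .inl x, .inl y => S₁.tau x y
    | .inr x, .inr y => S₂.tau x y
    | _, _ => 0

end LorentzianStructure

/-! ### Quotients -/

/-- The quotient of a space by an equivalence relation, to be equipped with the quotient
semi-metric. -/
def QuotSpace {X : Type*} (s : Setoid X) := Quotient s

namespace QuotSpace

section Chains

variable {X : Type*} {s : Setoid X}

/-- The canonical projection. -/
def mk (s : Setoid X) (x : X) : QuotSpace s := Quotient.mk s x

/-- A chain `(p 0, q 0), …, (p n, q n)` of `n + 1` pairs from `x` to `y`:
`x = [p 0]`, `[q i] = [p (i + 1)]` for `i < n`, and `[q n] = y`. -/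
structure IsChain (x y : QuotSpace s) (n : ℕ) (p q : ℕ → X) : Prop where
  start : mk s (p 0) = x
  jump : ∀ i < n, mk s (q i) = mk s (p (i + 1))
  finish : mk s (q n) = y

end Chains

variable {X : Type*} [PseudoEMetricSpace X] {s : Setoid X}

/-- The quotient semi-metric. -/
noncomputable def dist (x y : QuotSpace s) : ℝ≥0∞ :=
  ⨅ (n : ℕ) (p : ℕ → X) (q : ℕ → X) (_ : IsChain x y n p q),
    ∑ i ∈ Finset.range (n + 1), edist (p i) (q i)

theorem dist_le {x y : QuotSpace s} {n : ℕ} {p q : ℕ → X} (h : IsChain x y n p q) :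
    dist x y ≤ ∑ i ∈ Finset.range (n + 1), edist (p i) (q i) :=
  iInf_le_of_le n <| iInf_le_of_le p <| iInf_le_of_le q <| iInf_le_of_le h le_rfl

theorem dist_self (x : QuotSpace s) : dist x x = 0 := by
  obtain ⟨x, rfl⟩ : ∃ x', mk s x' = x := Quotient.exists_rep x
  refine le_antisymm ((dist_le (n := 0) (p := fun _ => x) (q := fun _ => x) ⟨rfl, ?_, rfl⟩).trans
    ?_) zero_le
  · simp
  · simp

theorem dist_comm_le (x y : QuotSpace s) : dist x y ≤ dist y x := by
  refine le_iInf fun n => le_iInf fun p => le_iInf fun q => le_iInf fun h => ?_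
  refine (dist_le (n := n) (p := fun i => q (n - i)) (q := fun i => p (n - i)) ⟨?_, ?_, ?_⟩).trans ?_
  · simpa using h.finish
  · intro i hi
    have := h.jump (n - (i + 1)) (by omega)
    rw [show n - (i + 1) + 1 = n - i by omega] at this
    exact this.symm
  · simpa using h.start
  · rw [← Finset.sum_range_reflect (fun i => edist (p i) (q i))]
    simp [edist_comm]

theorem dist_triangle (x y z : QuotSpace s) : dist x z ≤ dist x y + dist y z := by
  have key : ∀ (n : ℕ) (p q : ℕ → X) (_ : IsChain x y n p q) (m : ℕ) (p' q' : ℕ → X)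
      (_ : IsChain y z m p' q'),
      dist x z ≤ ∑ i ∈ Finset.range (n + 1), edist (p i) (q i) +
        ∑ i ∈ Finset.range (m + 1), edist (p' i) (q' i) := by
    intro n p q h m p' q' h'
    refine (dist_le (n := n + 1 + m) (p := fun i => if i < n + 1 then p i else p' (i - (n + 1)))
      (q := fun i => if i < n + 1 then q i else q' (i - (n + 1))) ⟨?_, ?_, ?_⟩).trans ?_
    · simpa using h.start
    · intro i hi
      rcases lt_trichotomy i n with hin | rfl | hin
      · rw [if_pos (by omega), if_pos (by omega)]
        exact h.jump i hin
      · rw [if_pos (by omega), if_neg (by omega), Nat.sub_self]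
        exact h.finish.trans h'.start.symm
      · rw [if_neg (by omega), if_neg (by omega),
          show i + 1 - (n + 1) = i - (n + 1) + 1 by omega]
        exact h'.jump _ (by omega)
    · rw [if_neg (by omega), Nat.add_sub_cancel_left]
      exact h'.finish
    · rw [add_assoc (n + 1) m 1, Finset.sum_range_add]
      refine le_of_eq (congrArg₂ (· + ·) (Finset.sum_congr rfl fun i hi => ?_)
        (Finset.sum_congr rfl fun i _ => ?_))
      · rw [if_pos (Finset.mem_range.1 hi), if_pos (Finset.mem_range.1 hi)]
      · rw [if_neg (by omega), if_neg (by omega), Nat.add_sub_cancel_left]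
  conv_rhs => unfold dist
  simp only [ENNReal.iInf_add, ENNReal.add_iInf]
  refine le_iInf fun m => le_iInf fun p' => le_iInf fun q' => le_iInf fun h' => ?_
  refine le_iInf fun n => le_iInf fun p => le_iInf fun q => le_iInf fun h => ?_
  exact key n p q h m p' q' h'

noncomputable instance : PseudoEMetricSpace (QuotSpace s) where
  edist := QuotSpace.dist
  edist_self := dist_self
  edist_comm x y := le_antisymm (dist_comm_le x y) (dist_comm_le y x)
  edist_triangle := dist_triangle

end QuotSpace

namespace LorentzianStructure

variable {X : Type*} (S : LorentzianStructure X) (s : Setoid X)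

/-- The quotient time separation `τ̃`: the supremum over all causal chains (`0` if there are
none). -/
noncomputable def quotTau (x y : QuotSpace s) : ℝ≥0∞ :=
  ⨆ (n : ℕ) (p : ℕ → X) (q : ℕ → X)
    (_ : QuotSpace.IsChain x y n p q ∧ ∀ i ≤ n, S.causal (p i) (q i)),
    ∑ i ∈ Finset.range (n + 1), S.tau (p i) (q i)

/-- The quotient Lorentzian structure. -/
noncomputable def quotient : LorentzianStructure (QuotSpace s) where
  chron x y := 0 < S.quotTau s x y
  causal x y := ∃ (n : ℕ) (p : ℕ → X) (q : ℕ → X),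
    QuotSpace.IsChain x y n p q ∧ ∀ i ≤ n, S.causal (p i) (q i)
  tau := S.quotTau s

end LorentzianStructure

/-! ### Amalgamation -/

section Amalgamation

variable {X₁ X₂ : Type*} {A₁ : Set X₁} {A₂ : Set X₂}

/-- The equivalence relation on the disjoint union generated by `a ∼ f a` for `a ∈ A₁`. -/
def gluingSetoid (f : A₁ → A₂) : Setoid (DisjUnion X₁ X₂) :=
  Relation.EqvGen.setoid fun x y => ∃ a : A₁, x = Sum.inl (a : X₁) ∧ y = Sum.inr (f a : X₂)

/-- The space `X₁ ⊔_A X₂`, with the quotient semi-metric of the disjoint union metric and the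
topology it induces. -/
abbrev Amalgamation (f : A₁ → A₂) := QuotSpace (gluingSetoid f)

/-- The Lorentzian structure of the amalgamation `X₁ ⊔_A X₂`. -/
noncomputable def LorentzianStructure.amalgamation (S₁ : LorentzianStructure X₁)
    (S₂ : LorentzianStructure X₂) (f : A₁ → A₂) : LorentzianStructure (Amalgamation f) :=
  (S₁.disjUnion S₂).quotient (gluingSetoid f)

variable [PseudoEMetricSpace X₁] [PseudoEMetricSpace X₂]

/-- Every `a ∈ A₁` has a neighbourhood `U` in `A₁` such that `f` restricted to `U`, and its
inverse `f(U) → U`, are Lipschitz. -/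
def LocallyBiLipschitz (f : A₁ ≃ₜ A₂) : Prop :=
  ∀ a : A₁, ∃ U ∈ 𝓝 a, ∃ K : ℝ≥0, LipschitzOnWith K f U ∧ LipschitzOnWith K f.symm (f '' U)

/-- The standing assumptions on the gluing: `A₁` and `A₂` are closed and non-timelike locally
isolating, and `f : A₁ → A₂` is a locally bi-Lipschitz homeomorphism which is compatible with
the existence of timelike futures and pasts, `τ`-preserving and `≤`-preserving. -/
structure IsLorentzianGluing (S₁ : LorentzianStructure X₁) (S₂ : LorentzianStructure X₂)
    (f : A₁ ≃ₜ A₂) : Prop where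
  isClosed_left : IsClosed A₁
  isClosed_right : IsClosed A₂
  nonTimelikeLocallyIsolating_left : S₁.NonTimelikeLocallyIsolating A₁
  nonTimelikeLocallyIsolating_right : S₂.NonTimelikeLocallyIsolating A₂
  locallyBiLipschitz : LocallyBiLipschitz f
  chronFuture_nonempty_iff : ∀ a : A₁,
    (S₁.chronFuture (a : X₁)).Nonempty ↔ (S₂.chronFuture (f a : X₂)).Nonempty
  chronPast_nonempty_iff : ∀ a : A₁,
    (S₁.chronPast (a : X₁)).Nonempty ↔ (S₂.chronPast (f a : X₂)).Nonempty
  tau_eq : ∀ a b : A₁, S₁.tau a b = S₂.tau (f a) (f b)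
  causal_iff : ∀ a b : A₁, S₁.causal a b ↔ S₂.causal (f a) (f b)

end Amalgamation

/-! On the causal side, chains in the quotient collapse. Since `f` preserves `≤` and `τ`, an
excursion into the other space that returns can be replaced by a relation in the original space, at
no loss of `τ` by the reverse triangle inequality. So one crossing of the gluing set suffices
(`chain_from_inl`, `chain_from_inr`). Both spaces therefore embed with their own `≪`, `≤`, `τ`, and
every relation between them factors through the gluing set. On the metric side, the local
bi-Lipschitz condition bounds the quotient metric from below near glued points
(`exists_gluingDist_le`), so it induces the quotient topology and both embeddings are topological
with closed image.

`IsGluedFrom` records these properties for a space covered by two closed pieces, and the theorem is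
derived from them. Because the gluing set is not timelike isolated, a crossing point between
chronologically related points can be moved to be timelike related to both (`exists_chron_between`).
This gives lower semicontinuity of `τ`, timelike curves, intrinsicness, and small diamonds around
each point (`exists_diamond_subset`).

A small diamond `W` is causally convex and meets each piece inside a compact patch on which `≤` is
closed and `τ` is finite and continuous. Crossing points between causally related points of `W` then
range over a compact set, so the best one is attained (`exists_tau_le_add`). Finiteness and
continuity of `τ`, closedness of `≤` and maximal curves on `W` follow. Metric lengths are bounded by
splitting the parameter interval according to the piece that the curve visits
(`exists_length_bound`). Hence `W` is localizable with `ω = τ`, and such `W` are arbitrarily small.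
-/

namespace LorentzianStructure

/-! ### Concatenation, translation and length of curves -/

section Curves

variable {X : Type*} {S : LorentzianStructure X}

/-- The concatenation of two curves that are parametrized on `[a, b]` and `[b, c]`. -/
noncomputable def concat (b : ℝ) (γ σ : ℝ → X) (t : ℝ) : X := if t ≤ b then γ t else σ t

theorem concat_eqOn_left (a b : ℝ) (γ σ : ℝ → X) : Set.EqOn γ (concat b γ σ) (Set.Icc a b) :=
  fun t ht => by simp [concat, ht.2]

theorem concat_eqOn_right {b c : ℝ} {γ σ : ℝ → X} (h : γ b = σ b) :
    Set.EqOn σ (concat b γ σ) (Set.Icc b c) := fun t ht => by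
  rcases ht.1.eq_or_lt with rfl | hlt
  · simp [concat, h]
  · simp [concat, not_le.2 hlt]

theorem concat_rel {R : X → X → Prop} (hR : ∀ x y z, R x y → R y z → R x z) {a b c : ℝ}
    (hab : a < b) (hbc : b < c) {γ : ℝ → X}
    (h₁ : ∀ s ∈ Set.Icc a b, ∀ t ∈ Set.Icc a b, s < t → R (γ s) (γ t))
    (h₂ : ∀ s ∈ Set.Icc b c, ∀ t ∈ Set.Icc b c, s < t → R (γ s) (γ t)) :
    ∀ s ∈ Set.Icc a c, ∀ t ∈ Set.Icc a c, s < t → R (γ s) (γ t) := by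
  intro s hs t ht hst
  rcases le_or_gt t b with htb | htb
  · exact h₁ s ⟨hs.1, hst.le.trans htb⟩ t ⟨ht.1, htb⟩ hst
  rcases le_or_gt b s with hsb | hsb
  · exact h₂ s ⟨hsb, hs.2⟩ t ⟨htb.le, ht.2⟩ hst
  · exact hR _ _ _ (h₁ s ⟨hs.1, hsb.le⟩ b ⟨hab.le, le_rfl⟩ hsb)
      (h₂ b ⟨le_rfl, hbc.le⟩ t ⟨htb.le, ht.2⟩ htb)

theorem tauLength_le_sum {a b : ℝ} {γ : ℝ → X} {n : ℕ} {t : ℕ → ℝ} (h : IsPartition a b n t) :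
    S.tauLength a b γ ≤ ∑ i ∈ Finset.range n, S.tau (γ (t i)) (γ (t (i + 1))) :=
  iInf_le_of_le n <| iInf_le_of_le t <| iInf_le_of_le h le_rfl

theorem IsPartition.mem_Icc {a b : ℝ} {n : ℕ} {t : ℕ → ℝ} (h : IsPartition a b n t) {i : ℕ}
    (hi : i ≤ n) : t i ∈ Set.Icc a b := by
  have hmono : ∀ j k, j ≤ k → k ≤ n → t j ≤ t k := by
    intro j k hjk
    induction k, hjk using Nat.le_induction with
    | base => exact fun _ => le_rfl
    | succ k _ ih => exact fun hk => (ih (by omega)).trans (h.lt k (by omega)).le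
  exact ⟨h.start ▸ hmono 0 i (Nat.zero_le _) hi, h.finish ▸ hmono i n hi le_rfl⟩

theorem tauLength_congr {a b : ℝ} {γ σ : ℝ → X} (e : Set.EqOn γ σ (Set.Icc a b)) :
    S.tauLength a b γ = S.tauLength a b σ := by
  refine iInf_congr fun n => iInf_congr fun t => iInf_congr fun h => Finset.sum_congr rfl ?_
  intro i hi
  have hi := Finset.mem_range.1 hi
  rw [e (h.mem_Icc hi.le), e (h.mem_Icc (Nat.succ_le_of_lt hi))]

theorem tauLength_translate (a b c : ℝ) (γ : ℝ → X) :
    S.tauLength a b γ ≤ S.tauLength (a + c) (b + c) fun t => γ (t - c) := by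
  refine le_iInf fun n => le_iInf fun t => le_iInf fun h => ?_
  exact tauLength_le_sum (t := fun i => t i - c)
    ⟨by simp [h.start], by simp [h.finish], fun i hi => by simpa using h.lt i hi⟩

/-- Prepending a point to a partition. -/
theorem tauLength_le_cons {x y b : ℝ} {γ : ℝ → X} {n : ℕ} {t : ℕ → ℝ} (hxy : x < y)
    (h : IsPartition y b n t) :
    S.tauLength x b γ ≤ S.tau (γ x) (γ y) +
      ∑ i ∈ Finset.range n, S.tau (γ (t i)) (γ (t (i + 1))) := by
  refine (tauLength_le_sum (n := n + 1) (t := fun i => Nat.casesOn i x t)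
    ⟨rfl, h.finish, ?_⟩).trans ?_
  · rintro (_ | i) hi
    · simpa [h.start] using hxy
    · exact h.lt i (by omega)
  · rw [Finset.sum_range_succ', add_comm]
    simp [h.start]

theorem tauLength_le_tau {a b : ℝ} (hab : a < b) (γ : ℝ → X) :
    S.tauLength a b γ ≤ S.tau (γ a) (γ b) := by
  simpa using tauLength_le_cons (S := S) (γ := γ) hab
    (⟨rfl, rfl, by simp⟩ : IsPartition b b 0 fun _ => b)

theorem tauLength_le_tau_add {x y b : ℝ} (hxy : x < y) (γ : ℝ → X) :
    S.tauLength x b γ ≤ S.tau (γ x) (γ y) + S.tauLength y b γ := by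
  conv_rhs => rw [tauLength]
  simp only [ENNReal.add_iInf]
  exact le_iInf fun n => le_iInf fun t => le_iInf fun h => tauLength_le_cons hxy h

variable [PseudoEMetricSpace X]

/-- Only the junction `b` matters: for parameters on opposite sides of it, the triangle inequality
through `γ b` loses nothing because `|y - b| + |b - z| = |y - z|`, so the larger of the two
constants works. -/
theorem locallyLipschitzOn_concat {a b c : ℝ} (hab : a ≤ b) (hbc : b ≤ c) {γ : ℝ → X}
    (h₁ : LocallyLipschitzOn (Set.Icc a b) γ) (h₂ : LocallyLipschitzOn (Set.Icc b c) γ) :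
    LocallyLipschitzOn (Set.Icc a c) γ := by
  intro x hx
  rcases lt_trichotomy x b with hxb | rfl | hxb
  · obtain ⟨K, t, ht, hK⟩ := h₁ ⟨hx.1, hxb.le⟩
    refine ⟨K, t, nhdsWithin_le_of_mem ?_ ht, hK⟩
    filter_upwards [self_mem_nhdsWithin, mem_nhdsWithin_of_mem_nhds (Iio_mem_nhds hxb)]
      with y hy hyb using ⟨hy.1, le_of_lt hyb⟩
  · obtain ⟨K₁, t₁, ht₁, hK₁⟩ := h₁ ⟨hab, le_rfl⟩
    obtain ⟨K₂, t₂, ht₂, hK₂⟩ := h₂ ⟨le_rfl, hbc⟩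
    have hx₁ : x ∈ t₁ := mem_of_mem_nhdsWithin (Set.right_mem_Icc.2 hab) ht₁
    have hx₂ : x ∈ t₂ := mem_of_mem_nhdsWithin (Set.left_mem_Icc.2 hbc) ht₂
    have key : ∀ y ∈ t₁ ∩ Set.Icc a x, ∀ z ∈ t₂ ∩ Set.Icc x c,
        edist (γ y) (γ z) ≤ (max K₁ K₂ : ℝ≥0) * edist y z := by
      intro y hy z hz
      have e : edist y x + edist x z = edist y z := by
        rw [edist_dist, edist_dist, edist_dist, ← ENNReal.ofReal_add dist_nonneg dist_nonneg,
          Real.dist_eq, Real.dist_eq, Real.dist_eq, abs_of_nonpos (by linarith [hy.2.2]),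
          abs_of_nonpos (by linarith [hz.2.1]), abs_of_nonpos (by linarith [hy.2.2, hz.2.1])]
        congr 1; ring
      calc edist (γ y) (γ z) ≤ edist (γ y) (γ x) + edist (γ x) (γ z) := edist_triangle _ _ _
        _ ≤ K₁ * edist y x + K₂ * edist x z := add_le_add (hK₁ hy.1 hx₁) (hK₂ hx₂ hz.1)
        _ ≤ (max K₁ K₂ : ℝ≥0) * edist y x + (max K₁ K₂ : ℝ≥0) * edist x z := by
          gcongr
          · exact le_max_left _ _
          · exact le_max_right _ _
        _ = _ := by rw [← mul_add, e]
    refine ⟨max K₁ K₂, (t₁ ∩ Set.Icc a x) ∪ (t₂ ∩ Set.Icc x c), ?_, ?_⟩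
    · rw [← Set.Icc_union_Icc_eq_Icc hab hbc, nhdsWithin_union]
      exact Filter.union_mem_sup (Filter.inter_mem ht₁ self_mem_nhdsWithin)
        (Filter.inter_mem ht₂ self_mem_nhdsWithin)
    · rintro y (hy | hy) z (hz | hz)
      · exact (hK₁ hy.1 hz.1).trans (by gcongr; exact le_max_left _ _)
      · exact key y hy z hz
      · rw [edist_comm, edist_comm y z]
        exact key z hz y hy
      · exact (hK₂ hy.1 hz.1).trans (by gcongr; exact le_max_right _ _)
  · obtain ⟨K, t, ht, hK⟩ := h₂ ⟨hxb.le, hx.2⟩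
    refine ⟨K, t, nhdsWithin_le_of_mem ?_ ht, hK⟩
    filter_upwards [self_mem_nhdsWithin, mem_nhdsWithin_of_mem_nhds (Ioi_mem_nhds hxb)]
      with y hy hyb using ⟨le_of_lt hyb, hy.2⟩

theorem locallyLipschitzOn_congr {s : Set ℝ} {γ σ : ℝ → X} (h : LocallyLipschitzOn s γ)
    (e : Set.EqOn γ σ s) : LocallyLipschitzOn s σ := by
  intro x hx
  obtain ⟨K, t, ht, hK⟩ := h hx
  refine ⟨K, t ∩ s, Filter.inter_mem ht self_mem_nhdsWithin, fun y hy z hz => ?_⟩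
  rw [← e hy.2, ← e hz.2]
  exact hK hy.1 hz.1

theorem locallyLipschitzOn_translate {a b : ℝ} {γ : ℝ → X}
    (h : LocallyLipschitzOn (Set.Icc a b) γ) (c : ℝ) :
    LocallyLipschitzOn (Set.Icc (a + c) (b + c)) fun t => γ (t - c) := by
  obtain hm : ∀ t ∈ Set.Icc (a + c) (b + c), t - c ∈ Set.Icc a b := fun t ht =>
    ⟨by linarith [ht.1], by linarith [ht.2]⟩
  intro x hx
  obtain ⟨K, t, ht, hK⟩ := h (hm x hx)
  have hc : Filter.Tendsto (fun t : ℝ => t - c) (𝓝[Set.Icc (a + c) (b + c)] x)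
      (𝓝[Set.Icc a b] (x - c)) :=
    tendsto_nhdsWithin_of_tendsto_nhds_of_eventually_within _
      ((continuous_sub_right c).continuousWithinAt) (by
        filter_upwards [self_mem_nhdsWithin] with y hy using hm y hy)
  refine ⟨K, _, hc ht, fun y hy z hz => ?_⟩
  simpa [edist_sub_right] using hK hy hz

theorem locallyLipschitzOn_comp {Y : Type*} [PseudoEMetricSpace Y] {s : Set ℝ}
    {γ : ℝ → X} {i : X → Y} {K : ℝ≥0} (hi : LipschitzWith K i) (h : LocallyLipschitzOn s γ) :
    LocallyLipschitzOn s (i ∘ γ) := by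
  intro x hx
  obtain ⟨L, t, ht, hL⟩ := h hx
  exact ⟨K * L, t, ht, hi.comp_lipschitzOnWith hL⟩

theorem IsCausalCurve.congr {a b : ℝ} {γ σ : ℝ → X} (h : S.IsCausalCurve a b γ)
    (e : Set.EqOn γ σ (Set.Icc a b)) : S.IsCausalCurve a b σ :=
  ⟨h.lt, locallyLipschitzOn_congr h.locallyLipschitz e, fun s hs t ht hst => by
    rw [← e hs, ← e ht]; exact h.causal s hs t ht hst⟩

theorem IsTimelikeCurve.congr {a b : ℝ} {γ σ : ℝ → X} (h : S.IsTimelikeCurve a b γ)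
    (e : Set.EqOn γ σ (Set.Icc a b)) : S.IsTimelikeCurve a b σ :=
  ⟨h.lt, locallyLipschitzOn_congr h.locallyLipschitz e, fun s hs t ht hst => by
    rw [← e hs, ← e ht]; exact h.chron s hs t ht hst⟩

theorem IsCausalCurve.append (htr : ∀ x y z, S.causal x y → S.causal y z → S.causal x z)
    {a b c : ℝ} {γ : ℝ → X} (h₁ : S.IsCausalCurve a b γ) (h₂ : S.IsCausalCurve b c γ) :
    S.IsCausalCurve a c γ :=
  ⟨h₁.lt.trans h₂.lt, locallyLipschitzOn_concat h₁.lt.le h₂.lt.le h₁.locallyLipschitz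
    h₂.locallyLipschitz, concat_rel htr h₁.lt h₂.lt h₁.causal h₂.causal⟩

theorem IsTimelikeCurve.append (htr : ∀ x y z, S.chron x y → S.chron y z → S.chron x z)
    {a b c : ℝ} {γ : ℝ → X} (h₁ : S.IsTimelikeCurve a b γ) (h₂ : S.IsTimelikeCurve b c γ) :
    S.IsTimelikeCurve a c γ :=
  ⟨h₁.lt.trans h₂.lt, locallyLipschitzOn_concat h₁.lt.le h₂.lt.le h₁.locallyLipschitz
    h₂.locallyLipschitz, concat_rel htr h₁.lt h₂.lt h₁.chron h₂.chron⟩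

theorem IsCausalCurve.translate {a b : ℝ} {γ : ℝ → X} (h : S.IsCausalCurve a b γ) (c : ℝ) :
    S.IsCausalCurve (a + c) (b + c) fun t => γ (t - c) :=
  ⟨by linarith [h.lt], locallyLipschitzOn_translate h.locallyLipschitz c, fun s hs t ht hst =>
    h.causal _ ⟨by linarith [hs.1], by linarith [hs.2]⟩ _ ⟨by linarith [ht.1], by linarith [ht.2]⟩
      (by linarith)⟩

theorem IsTimelikeCurve.translate {a b : ℝ} {γ : ℝ → X} (h : S.IsTimelikeCurve a b γ) (c : ℝ) :
    S.IsTimelikeCurve (a + c) (b + c) fun t => γ (t - c) :=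
  ⟨by linarith [h.lt], locallyLipschitzOn_translate h.locallyLipschitz c, fun s hs t ht hst =>
    h.chron _ ⟨by linarith [hs.1], by linarith [hs.2]⟩ _ ⟨by linarith [ht.1], by linarith [ht.2]⟩
      (by linarith)⟩

/-- By the reverse triangle inequality, inserting `b` into a partition of `[a, c]` does not increase
its sum, and the refined partition splits into one of `[a, b]` and one of `[b, c]`. -/
theorem IsCausalCurve.tauLength_add_le
    (hta : ∀ x y z, S.causal x y → S.causal y z → S.tau x y + S.tau y z ≤ S.tau x z)
    {a b c : ℝ} {γ : ℝ → X} (hγ : S.IsCausalCurve a c γ) (hab : a < b) (hbc : b < c) :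
    S.tauLength a b γ + S.tauLength b c γ ≤ S.tauLength a c γ := by
  -- The left end `x` varies so that cells can be peeled off one by one until a cell reaches or
  -- straddles `b`.
  have key : ∀ (n : ℕ) (x : ℝ) (t : ℕ → ℝ), a ≤ x → x < b → IsPartition x c n t →
      S.tauLength x b γ + S.tauLength b c γ ≤
        ∑ i ∈ Finset.range n, S.tau (γ (t i)) (γ (t (i + 1))) := by
    intro n
    induction n with
    | zero =>
      intro x t _ hxb h
      have := h.start.symm.trans h.finish
      linarith
    | succ n ih =>
      intro x t hax hxb h
      have h' : IsPartition (t 1) c n fun i => t (i + 1) :=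
        ⟨rfl, h.finish, fun i hi => h.lt (i + 1) (by omega)⟩
      have hx1 : x < t 1 := h.start ▸ h.lt 0 (by omega)
      have h1c : t 1 ≤ c := (h.mem_Icc (i := 1) (by omega)).2
      rw [Finset.sum_range_succ', add_comm (Finset.sum _ _), zero_add, h.start]
      rcases lt_trichotomy (t 1) b with h1 | h1 | h1
      · calc _ ≤ S.tau (γ x) (γ (t 1)) + S.tauLength (t 1) b γ + S.tauLength b c γ := by
              gcongr; exact tauLength_le_tau_add hx1 γ
          _ ≤ _ := by
            rw [add_assoc]; gcongr; exact ih _ _ (hax.trans hx1.le) h1 h'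
      · rw [h1] at h' ⊢
        exact add_le_add (tauLength_le_tau hxb γ) (tauLength_le_sum h')
      · calc _ ≤ S.tau (γ x) (γ b) + (S.tau (γ b) (γ (t 1)) + ∑ i ∈ Finset.range n,
              S.tau (γ (t (i + 1))) (γ (t (i + 1 + 1)))) :=
              add_le_add (tauLength_le_tau hxb γ) (tauLength_le_cons h1 h')
          _ ≤ _ := by
            rw [← add_assoc]; gcongr
            exact hta _ _ _
              (hγ.causal _ ⟨hax, by linarith⟩ _ ⟨by linarith, by linarith⟩ hxb)
              (hγ.causal _ ⟨by linarith, by linarith⟩ _ ⟨by linarith, h1c⟩ h1)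
  exact le_iInf fun n => le_iInf fun t => le_iInf fun h => key n a t le_rfl hab h

/-- Causal curves can be concatenated, and `τ`-lengths and `d`-lengths are superadditive under
concatenation. -/
theorem exists_causalCurve_concat
    (htr : ∀ x y z, S.causal x y → S.causal y z → S.causal x z)
    (hta : ∀ x y z, S.causal x y → S.causal y z → S.tau x y + S.tau y z ≤ S.tau x z)
    {a b a' b' : ℝ} {γ σ : ℝ → X} (hγ : S.IsCausalCurve a b γ) (hσ : S.IsCausalCurve a' b' σ)
    (h : γ b = σ a') :
    ∃ (c : ℝ) (ρ : ℝ → X), S.IsCausalCurve a c ρ ∧ ρ a = γ a ∧ ρ c = σ b' ∧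
      S.tauLength a b γ + S.tauLength a' b' σ ≤ S.tauLength a c ρ ∧
      eVariationOn γ (Set.Icc a b) + edist (σ a') (σ b') ≤ eVariationOn ρ (Set.Icc a c) := by
  have hσ' := hσ.translate (b - a')
  set σ' : ℝ → X := fun t => σ (t - (b - a')) with hσ'_def
  have hL := tauLength_translate (S := S) a' b' (b - a') σ
  rw [add_sub_cancel] at hσ' hL
  have hb : γ b = σ' b := by simp [hσ'_def, h]
  have e₁ := concat_eqOn_left a b γ σ'
  have e₂ := concat_eqOn_right (c := b' + (b - a')) hb
  have hρ := (hγ.congr e₁).append htr (hσ'.congr e₂)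
  have hbc := hσ'.lt
  have hc : concat b γ σ' (b' + (b - a')) = σ b' := by
    rw [← e₂ ⟨hbc.le, le_rfl⟩]; simp [hσ'_def]
  refine ⟨b' + (b - a'), concat b γ σ', hρ, (e₁ ⟨le_rfl, hγ.lt.le⟩).symm, hc, ?_, ?_⟩
  · refine le_trans ?_ (hρ.tauLength_add_le hta hγ.lt hbc)
    rw [tauLength_congr e₁, ← tauLength_congr e₂]
    gcongr
  -- Only the chord of the second curve is kept; this is what summing along a chain of points
  -- requires.
  · have := eVariationOn.Icc_add_Icc (concat b γ σ') (s := Set.univ) hγ.lt.le hbc.le trivial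
    simp only [Set.univ_inter] at this
    rw [← this, eVariationOn.eq_of_eqOn e₁]
    gcongr
    rw [← h, ← hc, e₁ ⟨hγ.lt.le, le_rfl⟩]
    exact eVariationOn.edist_le _ ⟨le_rfl, hbc.le⟩ ⟨hbc.le, le_rfl⟩

theorem exists_timelikeCurve_concat
    (htr : ∀ x y z, S.chron x y → S.chron y z → S.chron x z)
    {a b a' b' : ℝ} {γ σ : ℝ → X} (hγ : S.IsTimelikeCurve a b γ)
    (hσ : S.IsTimelikeCurve a' b' σ) (h : γ b = σ a') :
    ∃ (c : ℝ) (ρ : ℝ → X), S.IsTimelikeCurve a c ρ ∧ ρ a = γ a ∧ ρ c = σ b' := by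
  have hσ' := hσ.translate (b - a')
  set σ' : ℝ → X := fun t => σ (t - (b - a')) with hσ'_def
  rw [add_sub_cancel] at hσ'
  have hb : γ b = σ' b := by simp [hσ'_def, h]
  have e₁ := concat_eqOn_left a b γ σ'
  have e₂ := concat_eqOn_right (c := b' + (b - a')) hb
  refine ⟨b' + (b - a'), concat b γ σ', (hγ.congr e₁).append htr (hσ'.congr e₂),
    (e₁ ⟨le_rfl, hγ.lt.le⟩).symm, ?_⟩
  rw [← e₂ ⟨hσ'.lt.le, le_rfl⟩]; simp [hσ'_def]

end Curves

end LorentzianStructure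

/-- Turns a strict bound on a sum into strict bounds on its terms, to which lower semicontinuity
applies separately. Both terms must be positive to leave room below them. -/
theorem ENNReal.exists_lt_lt_add {u v c : ℝ≥0∞} (hu : 0 < u) (hv : 0 < v) (h : c < u + v) :
    ∃ u' < u, ∃ v' < v, c < u' + v' := by
  have key : ∀ u v : ℝ≥0∞, 0 < u → c < u + v → ∃ u' < u, c < u' + v := by
    intro u v hu h
    have hc : Continuous fun u' : ℝ≥0∞ => u' + v := by fun_prop
    have hev : ∀ᶠ u' in 𝓝[<] u, c < u' + v :=
      nhdsWithin_le_nhds (hc.continuousAt.eventually_const_lt h)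
    have : (𝓝[<] u).NeBot := nhdsLT_neBot_of_exists_lt ⟨0, hu⟩
    obtain ⟨u', h₁, h₂⟩ := (hev.and self_mem_nhdsWithin).exists
    exact ⟨u', h₂, h₁⟩
  obtain ⟨u', hu', h₁⟩ := key u v hu h
  obtain ⟨v', hv', h₂⟩ := key v u' hv (by rwa [add_comm])
  exact ⟨u', hu', v', hv', by rwa [add_comm]⟩

/-- The variations of `f` over the parts of `s` in the cells of a subdivision add up to at most the
variation over `s`. -/
theorem eVariationOn.sum_inter_Icc_le {E : Type*} [PseudoEMetricSpace E] (f : ℝ → E) (s : Set ℝ)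
    {u : ℕ → ℝ} (hu : Monotone u) (n : ℕ) :
    ∑ i ∈ Finset.range n, eVariationOn f (s ∩ Set.Icc (u i) (u (i + 1))) ≤
      eVariationOn f (s ∩ Set.Icc (u 0) (u n)) := by
  induction n with
  | zero => simp
  | succ n ih =>
    rw [Finset.sum_range_succ]
    refine (add_le_add_left ih _).trans ((eVariationOn.add_le_union f ?_).trans ?_)
    · exact fun x hx y hy => hx.2.2.trans hy.2.1
    · refine eVariationOn.mono f ?_
      rintro x (hx | hx)
      · exact ⟨hx.1, hx.2.1, hx.2.2.trans (hu n.le_succ)⟩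
      · exact ⟨hx.1, (hu n.zero_le).trans hx.2.1, hx.2.2⟩

/-! ### Abstract spaces glued from two closed pieces -/

namespace LorentzianStructure

variable {Y : Type*} [PseudoEMetricSpace Y]

/-- A compact part `K` of a piece `Z` of a space on which the causal relation is closed, the time
separation is finite and continuous, causal chains have bounded length, and causally related points
are joined by causal curves whose length is their time separation. -/
structure IsPatch (T : LorentzianStructure Y) (Z K : Set Y) : Prop where
  subset : K ⊆ Z
  isCompact : IsCompact K
  causal_of_frequently : ∀ p ∈ K, ∀ q ∈ K,
    (∃ᶠ r in 𝓝[K ×ˢ K] (p, q), T.causal r.1 r.2) → T.causal p q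
  tau_ne_top : ∀ p ∈ K, ∀ q ∈ K, T.tau p q ≠ ∞
  continuousOn_tau : ContinuousOn (fun r : Y × Y => T.tau r.1 r.2) (K ×ˢ K)
  -- The set of times is arbitrary because the times that a causal curve spends in one piece need
  -- not form an interval.
  exists_variation_bound : ∃ C : ℝ≥0, ∀ (g : ℝ → Y) (s : Set ℝ), Set.MapsTo g s K →
    (∀ x ∈ s, ∀ y ∈ s, x < y → T.causal (g x) (g y)) → eVariationOn g s ≤ C
  exists_maximal : ∀ p ∈ K, ∀ q ∈ K, T.causal p q → ∃ (a b : ℝ) (γ : ℝ → Y),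
    T.IsCausalCurve a b γ ∧ γ a = p ∧ γ b = q ∧ T.tau p q ≤ T.tauLength a b γ

/-- The algebraic axioms of a Lorentzian pre-length space (all but lower semicontinuity of `τ` and
the separation axiom for the metric). -/
structure IsAlgebraic {Y : Type*} (T : LorentzianStructure Y) : Prop where
  causal_refl : ∀ x, T.causal x x
  causal_trans : ∀ x y z, T.causal x y → T.causal y z → T.causal x z
  chron_trans : ∀ x y z, T.chron x y → T.chron y z → T.chron x z
  causal_of_chron : ∀ x y, T.chron x y → T.causal x y
  tau_add_le : ∀ x y z, T.causal x y → T.causal y z → T.tau x y + T.tau y z ≤ T.tau x z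
  tau_pos_iff : ∀ x y, 0 < T.tau x y ↔ T.chron x y

theorem IsPreLengthSpace.isAlgebraic {T : LorentzianStructure Y} (h : T.IsPreLengthSpace) :
    T.IsAlgebraic :=
  ⟨h.causal_refl, h.causal_trans, h.chron_trans, h.causal_of_chron, h.tau_add_le, h.tau_pos_iff⟩

namespace IsAlgebraic

variable {Y : Type*} {T : LorentzianStructure Y} (h : T.IsAlgebraic)
include h

theorem chron_of_causal_of_chron {x y z : Y} (h₁ : T.causal x y) (h₂ : T.chron y z) :
    T.chron x z :=
  (h.tau_pos_iff _ _).1 <| ((h.tau_pos_iff _ _).2 h₂).trans_le <|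
    le_add_self.trans (h.tau_add_le _ _ _ h₁ (h.causal_of_chron _ _ h₂))

theorem chron_of_chron_of_causal {x y z : Y} (h₁ : T.chron x y) (h₂ : T.causal y z) :
    T.chron x z :=
  (h.tau_pos_iff _ _).1 <| ((h.tau_pos_iff _ _).2 h₁).trans_le <|
    le_self_add.trans (h.tau_add_le _ _ _ (h.causal_of_chron _ _ h₁) h₂)

theorem causal_of_tau_pos {x y : Y} (hxy : 0 < T.tau x y) : T.causal x y :=
  h.causal_of_chron _ _ ((h.tau_pos_iff _ _).1 hxy)

theorem diamond_convex {u v p q z : Y} (hp : p ∈ T.diamond u v) (hq : q ∈ T.diamond u v)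
    (hpz : T.causal p z) (hzq : T.causal z q) : z ∈ T.diamond u v :=
  ⟨h.chron_of_chron_of_causal hp.1 hpz, h.chron_of_causal_of_chron hzq hq.2⟩

end IsAlgebraic

/-- A space that is covered by two closed pieces, each of which behaves like a strongly causal,
locally compact Lorentzian length space, such that all causal relations between the two pieces
factor through their intersection. -/
structure IsGluedFrom (T : LorentzianStructure Y) (Z : Bool → Set Y) : Prop
    extends T.IsAlgebraic where
  eq_of_edist_eq_zero : ∀ x y : Y, edist x y = 0 → x = y
  isClosed : ∀ k, IsClosed (Z k)
  cover : ∀ y, ∃ k, y ∈ Z k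
  -- Keeping `b` in every piece that contains `a` allows a crossing point to be moved without
  -- leaving the intersection.
  exists_future : ∀ a, ∀ U ∈ 𝓝 a, ∃ b ∈ U, T.chron a b ∧ ∀ k, a ∈ Z k → b ∈ Z k
  exists_past : ∀ a, ∀ U ∈ 𝓝 a, ∃ b ∈ U, T.chron b a ∧ ∀ k, a ∈ Z k → b ∈ Z k
  exists_between : ∀ k l, ∀ x ∈ Z k, ∀ y ∈ Z l, T.causal x y →
    ∃ a, a ∈ Z k ∧ a ∈ Z l ∧ T.causal x a ∧ T.causal a y
  -- Globally `τ` is only a supremum over crossing points, hence the approximation by `c`.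
  exists_tau_between : ∀ k l, ∀ x ∈ Z k, ∀ y ∈ Z l, ∀ c < T.tau x y,
    ∃ a, a ∈ Z k ∧ a ∈ Z l ∧ T.causal x a ∧ T.causal a y ∧ c < T.tau x a + T.tau a y
  lsc_left : ∀ k, ∀ x ∈ Z k, ∀ y ∈ Z k, ∀ c < T.tau x y, ∀ᶠ x' in 𝓝[Z k] x, c < T.tau x' y
  lsc_right : ∀ k, ∀ x ∈ Z k, ∀ y ∈ Z k, ∀ c < T.tau x y, ∀ᶠ y' in 𝓝[Z k] y, c < T.tau x y'
  exists_diamond : ∀ k, ∀ y ∈ Z k, ∀ V ∈ 𝓝 y, ∃ u ∈ Z k, ∃ v ∈ Z k, y ∈ T.diamond u v ∧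
    Z k ∩ T.diamond u v ⊆ V
  exists_patch : ∀ k y, ∃ K, T.IsPatch (Z k) K ∧ ∀ᶠ z in 𝓝 y, z ∈ Z k → z ∈ K
  exists_timelike : ∀ k, ∀ x ∈ Z k, ∀ y ∈ Z k, T.chron x y → ∃ (a b : ℝ) (γ : ℝ → Y),
    T.IsTimelikeCurve a b γ ∧ γ a = x ∧ γ b = y
  exists_causal : ∀ k, ∀ x ∈ Z k, ∀ y ∈ Z k, T.causal x y → ∃ (a b : ℝ) (γ : ℝ → Y),
    T.IsCausalCurve a b γ ∧ γ a = x ∧ γ b = y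
  exists_length_gt : ∀ k, ∀ x ∈ Z k, ∀ y ∈ Z k, ∀ c < T.tau x y, ∃ (a b : ℝ) (γ : ℝ → Y),
    T.IsCausalCurve a b γ ∧ γ a = x ∧ γ b = y ∧ c < T.tauLength a b γ

/-- A causally convex open set that is covered by patches. -/
structure IsPatched (T : LorentzianStructure Y) (Z K : Bool → Set Y) (W : Set Y) : Prop where
  isOpen : IsOpen W
  convex : ∀ p ∈ W, ∀ q ∈ W, ∀ z, T.causal p z → T.causal z q → z ∈ W
  isPatch : ∀ k, T.IsPatch (Z k) (K k)
  inter_subset : ∀ k, ∀ z ∈ W, z ∈ Z k → z ∈ K k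

namespace IsGluedFrom

variable {T : LorentzianStructure Y} {Z K : Bool → Set Y} {W : Set Y}

section
variable (h : T.IsGluedFrom Z)
include h

theorem nhds_eq (y : Y) : 𝓝 y = ⨆ k, 𝓝[Z k] y := by
  have : (⋃ k, Z k) = Set.univ := Set.eq_univ_of_forall fun y => Set.mem_iUnion.2 (h.cover y)
  rw [← nhdsWithin_univ, ← this, nhdsWithin_iUnion]

theorem nhdsWithin_eq_bot {k : Bool} {y : Y} (hy : y ∉ Z k) : 𝓝[Z k] y = ⊥ := by
  rwa [← Filter.not_neBot, ← mem_closure_iff_nhdsWithin_neBot, (h.isClosed k).closure_eq]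

/-- If a crossing point has zero `τ` to one endpoint, the other term alone exceeds `c`. By
semicontinuity the point may then be pushed slightly into its future or past, inside its pieces, so
that both relations become timelike and the bound survives. -/
theorem exists_chron_between {k l : Bool} {x y : Y} (hx : x ∈ Z k) (hy : y ∈ Z l) {c : ℝ≥0∞}
    (hc : c < T.tau x y) : ∃ a, a ∈ Z k ∧ a ∈ Z l ∧ T.chron x a ∧ T.chron a y ∧
      c < T.tau x a + T.tau a y := by
  obtain ⟨a, hak, hal, hxa, hay, hlt⟩ := h.exists_tau_between k l x hx y hy c hc
  rcases eq_zero_or_pos (T.tau x a) with h0 | h₁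
  · have h₂ : 0 < T.tau a y := by
      rw [h0, zero_add] at hlt; exact pos_of_gt hlt
    rw [h0, zero_add] at hlt
    obtain ⟨U, hU, hUa⟩ := (mem_nhdsWithin_iff_exists_mem_nhds_inter).1
      (h.lsc_left l a hal y hy c hlt)
    obtain ⟨b, hbU, hab, hb⟩ := h.exists_future a U hU
    have hcb : c < T.tau b y := hUa ⟨hbU, hb l hal⟩
    exact ⟨b, hb k hak, hb l hal, h.chron_of_causal_of_chron hxa hab,
      (h.tau_pos_iff _ _).1 (pos_of_gt hcb), hcb.trans_le le_add_self⟩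
  rcases eq_zero_or_pos (T.tau a y) with h0 | h₂
  · rw [h0, add_zero] at hlt
    obtain ⟨U, hU, hUa⟩ := (mem_nhdsWithin_iff_exists_mem_nhds_inter).1
      (h.lsc_right k x hx a hak c hlt)
    obtain ⟨b, hbU, hba, hb⟩ := h.exists_past a U hU
    have hcb : c < T.tau x b := hUa ⟨hbU, hb k hak⟩
    exact ⟨b, hb k hak, hb l hal, (h.tau_pos_iff _ _).1 (pos_of_gt hcb),
      h.chron_of_chron_of_causal hba hay, hcb.trans_le le_self_add⟩
  exact ⟨a, hak, hal, (h.tau_pos_iff _ _).1 h₁, (h.tau_pos_iff _ _).1 h₂, hlt⟩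

/-- Through a fixed crossing point timelike related to both ends, the two terms can be bounded below
independently as each end moves in its own piece; the reverse triangle inequality recombines them.
Neighbourhood filters are finite suprema over the pieces, trivial for pieces that miss the point. -/
theorem lowerSemicontinuous_tau : LowerSemicontinuous fun p : Y × Y => T.tau p.1 p.2 := by
  rintro ⟨x, y⟩ c hc
  dsimp only at hc
  have key : ∀ k l, ∀ᶠ p in 𝓝[Z k] x ×ˢ 𝓝[Z l] y, c < T.tau p.1 p.2 := by
    intro k l
    by_cases hx : x ∈ Z k
    swap; · simp [h.nhdsWithin_eq_bot hx]
    by_cases hy : y ∈ Z l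
    swap; · simp [h.nhdsWithin_eq_bot hy]
    obtain ⟨a, hak, hal, hxa, hay, hlt⟩ := h.exists_chron_between hx hy hc
    obtain ⟨u, hu, v, hv, huv⟩ := ENNReal.exists_lt_lt_add ((h.tau_pos_iff _ _).2 hxa)
      ((h.tau_pos_iff _ _).2 hay) hlt
    filter_upwards [(h.lsc_left k x hx a hak u hu).prod_mk (h.lsc_right l a hal y hy v hv)]
      with p hp
    exact huv.trans_le ((add_le_add hp.1.le hp.2.le).trans (h.tau_add_le _ _ _
      (h.causal_of_tau_pos (pos_of_gt hp.1)) (h.causal_of_tau_pos (pos_of_gt hp.2))))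
  rw [nhds_prod_eq, h.nhds_eq x, h.nhds_eq y]
  simp only [iSup_bool_eq, Filter.sup_prod, Filter.prod_sup, Filter.eventually_sup]
  exact ⟨⟨key _ _, key _ _⟩, key _ _, key _ _⟩

theorem isPreLengthSpace : T.IsPreLengthSpace :=
  ⟨h.eq_of_edist_eq_zero, h.causal_refl, h.causal_trans, h.chron_trans, h.causal_of_chron,
    h.lowerSemicontinuous_tau, h.tau_add_le, h.tau_pos_iff⟩

end

end IsGluedFrom

theorem IsPreLengthSpace.isOpen_chronFuture {T : LorentzianStructure Y} (h : T.IsPreLengthSpace)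
    (x : Y) : IsOpen (T.chronFuture x) := by
  have := (h.lowerSemicontinuous_tau.isOpen_preimage 0).preimage
    (continuous_const.prodMk continuous_id : Continuous fun y => (x, y))
  convert this using 1
  ext y
  exact (h.tau_pos_iff x y).symm

theorem IsPreLengthSpace.isOpen_chronPast {T : LorentzianStructure Y} (h : T.IsPreLengthSpace)
    (x : Y) : IsOpen (T.chronPast x) := by
  have := (h.lowerSemicontinuous_tau.isOpen_preimage 0).preimage
    (continuous_id.prodMk continuous_const : Continuous fun y => (y, x))
  convert this using 1
  ext y
  exact (h.tau_pos_iff y x).symm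

theorem IsPreLengthSpace.isOpen_diamond {T : LorentzianStructure Y} (h : T.IsPreLengthSpace)
    (x y : Y) : IsOpen (T.diamond x y) :=
  (h.isOpen_chronFuture x).inter (h.isOpen_chronPast y)

namespace IsGluedFrom

variable {T : LorentzianStructure Y} {Z K : Bool → Set Y} {W : Set Y}

section
variable (h : T.IsGluedFrom Z)
include h

/-- Each piece through `y` has a diamond whose trace on that piece is small. A diamond with
endpoints close to `y` lies in all of them, and it cannot reach a piece missing `y` without first
crossing into it near `y`. -/
theorem exists_diamond_subset (y : Y) (V : Set Y) (hV : V ∈ 𝓝 y) :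
    ∃ u v, y ∈ T.diamond u v ∧ T.diamond u v ⊆ V := by
  -- Near `y`, closedness of the pieces excludes every piece that does not contain `y`.
  set V' : Set Y := {z ∈ V | ∀ k, z ∈ Z k → y ∈ Z k} with hV'_def
  have hV' : V' ∈ 𝓝 y := by
    refine Filter.inter_mem hV (Filter.eventually_all.2 fun k => ?_)
    by_cases hk : y ∈ Z k
    · exact Filter.Eventually.of_forall fun _ _ => hk
    · filter_upwards [(h.isClosed k).isOpen_compl.mem_nhds hk] with z hz hz' using absurd hz' hz
  have hk : ∀ k, ∃ u v, y ∈ T.diamond u v ∧ (y ∈ Z k → Z k ∩ T.diamond u v ⊆ V') := by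
    intro k
    obtain ⟨l, hl⟩ := h.cover y
    by_cases hy : y ∈ Z k
    · obtain ⟨u, _, v, _, hy', hsub⟩ := h.exists_diamond k y hy V' hV'
      exact ⟨u, v, hy', fun _ => hsub⟩
    · obtain ⟨u, _, v, _, hy', _⟩ := h.exists_diamond l y hl V' hV'
      exact ⟨u, v, hy', fun hy' => absurd hy' hy⟩
  choose u v hyuv hsub using hk
  obtain ⟨u', hu', hu'y, hu'Z⟩ := h.exists_past y (⋂ k, T.chronFuture (u k))
    (Filter.iInter_mem.2 fun k =>
      (h.isPreLengthSpace.isOpen_chronFuture (u k)).mem_nhds (hyuv k).1)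
  obtain ⟨v', hv', hv'y, hv'Z⟩ := h.exists_future y (⋂ k, T.chronPast (v k))
    (Filter.iInter_mem.2 fun k =>
      (h.isPreLengthSpace.isOpen_chronPast (v k)).mem_nhds (hyuv k).2)
  have hin : ∀ k, y ∈ Z k → Z k ∩ T.diamond u' v' ⊆ V' := fun k hk z hz =>
    hsub k hk ⟨hz.1, h.chron_trans _ _ _ (Set.mem_iInter.1 hu' k) hz.2.1,
      h.chron_trans _ _ _ hz.2.2 (Set.mem_iInter.1 hv' k)⟩
  refine ⟨u', v', ⟨hu'y, hv'y⟩, fun z hz => ?_⟩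
  obtain ⟨k, hk⟩ := h.cover z
  suffices hy : y ∈ Z k from (hin k hy ⟨hk, hz⟩).1
  obtain ⟨l, hl⟩ := h.cover y
  -- The crossing point lies in the diamond and in a piece through `y`, hence in `V'`; since it also
  -- lies in the piece of `z`, that piece contains `y`.
  obtain ⟨a, hal, hak, hua, haz, _⟩ := h.exists_chron_between (hu'Z l hl) hk
    ((h.tau_pos_iff _ _).2 hz.1)
  exact (hin l hl ⟨hal, hua, h.chron_trans _ _ _ haz hz.2⟩).2 k hak

theorem exists_isPatched (y : Y) (V : Set Y) (hV : V ∈ 𝓝 y) :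
    ∃ K W, T.IsPatched Z K W ∧ y ∈ W ∧ W ⊆ V := by
  choose K hK hKy using fun k => h.exists_patch k y
  obtain ⟨u, v, hy, hsub⟩ := h.exists_diamond_subset y (V ∩ {z | ∀ k, z ∈ Z k → z ∈ K k})
    (Filter.inter_mem hV (Filter.eventually_all.2 hKy))
  exact ⟨K, T.diamond u v, ⟨h.isPreLengthSpace.isOpen_diamond u v,
    fun p hp q hq z => h.diamond_convex hp hq, hK, fun k z hz => (hsub hz).2 k⟩, hy,
    fun z hz => (hsub hz).1⟩

theorem causallyPathConnected : T.CausallyPathConnected := by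
  constructor
  · intro x y hxy
    obtain ⟨k, hk⟩ := h.cover x
    obtain ⟨l, hl⟩ := h.cover y
    obtain ⟨a, hak, hal, hxa, hay, _⟩ := h.exists_chron_between hk hl ((h.tau_pos_iff _ _).2 hxy)
    obtain ⟨a₁, b₁, γ₁, hγ₁, hs₁, ht₁⟩ := h.exists_timelike k x hk a hak hxa
    obtain ⟨a₂, b₂, γ₂, hγ₂, hs₂, ht₂⟩ := h.exists_timelike l a hal y hl hay
    obtain ⟨c, ρ, hρ, hs, ht⟩ :=
      exists_timelikeCurve_concat h.chron_trans hγ₁ hγ₂ (ht₁.trans hs₂.symm)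
    exact ⟨a₁, c, ρ, hρ, hs.trans hs₁, ht.trans ht₂⟩
  · intro x y hxy
    obtain ⟨k, hk⟩ := h.cover x
    obtain ⟨l, hl⟩ := h.cover y
    obtain ⟨a, hak, hal, hxa, hay⟩ := h.exists_between k l x hk y hl hxy
    obtain ⟨a₁, b₁, γ₁, hγ₁, hs₁, ht₁⟩ := h.exists_causal k x hk a hak hxa
    obtain ⟨a₂, b₂, γ₂, hγ₂, hs₂, ht₂⟩ := h.exists_causal l a hal y hl hay
    obtain ⟨c, ρ, hρ, hs, ht, _⟩ :=
      exists_causalCurve_concat h.causal_trans h.tau_add_le hγ₁ hγ₂ (ht₁.trans hs₂.symm)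
    exact ⟨a₁, c, ρ, hρ, hs.trans hs₁, ht.trans ht₂⟩

theorem intrinsic : T.Intrinsic := by
  intro x y
  refine le_antisymm (le_of_forall_lt fun c hc => ?_) ?_
  · obtain ⟨k, hk⟩ := h.cover x
    obtain ⟨l, hl⟩ := h.cover y
    obtain ⟨a, hak, hal, hxa, hay, hlt⟩ := h.exists_chron_between hk hl hc
    obtain ⟨u, hu, v, hv, huv⟩ := ENNReal.exists_lt_lt_add ((h.tau_pos_iff _ _).2 hxa)
      ((h.tau_pos_iff _ _).2 hay) hlt
    obtain ⟨a₁, b₁, γ₁, hγ₁, hs₁, ht₁, hl₁⟩ := h.exists_length_gt k x hk a hak u hu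
    obtain ⟨a₂, b₂, γ₂, hγ₂, hs₂, ht₂, hl₂⟩ := h.exists_length_gt l a hal y hl v hv
    obtain ⟨c, ρ, hρ, hs, ht, hL, _⟩ :=
      exists_causalCurve_concat h.causal_trans h.tau_add_le hγ₁ hγ₂ (ht₁.trans hs₂.symm)
    refine huv.trans_le ((add_le_add hl₁.le hl₂.le).trans (hL.trans ?_))
    exact le_iSup_of_le a₁ <| le_iSup_of_le c <| le_iSup_of_le ρ <|
      le_iSup_of_le ⟨hρ, hs.trans hs₁, ht.trans ht₂⟩ le_rfl
  · refine iSup_le fun a => iSup_le fun b => iSup_le fun γ => iSup_le fun hγ => ?_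
    rw [← hγ.2.1, ← hγ.2.2]
    exact tauLength_le_tau hγ.1.lt γ

end

end IsGluedFrom

end LorentzianStructure

/-! ### Localizability of glued spaces -/

namespace LorentzianStructure

theorem IsAlgebraic.tau_eq_zero {Y : Type*} {T : LorentzianStructure Y} (h : T.IsAlgebraic)
    {p q : Y} (hpq : ¬ T.causal p q) : T.tau p q = 0 := by
  by_contra h0
  exact hpq (h.causal_of_tau_pos (pos_iff_ne_zero.2 h0))

namespace IsGluedFrom

variable {Y : Type*} [PseudoEMetricSpace Y] {T : LorentzianStructure Y} {Z K : Bool → Set Y}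
  {W : Set Y}

variable (h : T.IsGluedFrom Z)
include h

theorem t2Space : T2Space Y := by
  have : T0Space Y := ⟨fun x y hxy => h.eq_of_edist_eq_zero x y (EMetric.inseparable_iff.1 hxy)⟩
  infer_instance

variable (hW : T.IsPatched Z K W)
include hW

/-- By convexity of `W` all crossing points lie in both patches, and closedness of `≤` there makes
their set `C` compact. The continuous function `τ(p, a) + τ(a, q)` has a maximum on `C`, which
cannot lie below `τ(p, q)`, as a better crossing point would exist otherwise. -/
theorem exists_tau_le_add {k l : Bool} {p q : Y} (hp : p ∈ W) (hq : q ∈ W) (hpk : p ∈ Z k)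
    (hql : q ∈ Z l) (hpq : T.causal p q) : ∃ a, a ∈ K k ∧ a ∈ K l ∧ T.causal p a ∧ T.causal a q ∧
      T.tau p q ≤ T.tau p a + T.tau a q := by
  have := h.t2Space
  have hpK := hW.inter_subset k p hp hpk
  have hqK := hW.inter_subset l q hq hql
  set C : Set Y := {a | (a ∈ K k ∧ a ∈ K l) ∧ T.causal p a ∧ T.causal a q} with hC_def
  have mem_C : ∀ a, a ∈ Z k → a ∈ Z l → T.causal p a → T.causal a q → a ∈ C := by
    intro a hak hal hpa haq
    have haW := hW.convex p hp q hq a hpa haq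
    exact ⟨⟨hW.inter_subset k a haW hak, hW.inter_subset l a haW hal⟩, hpa, haq⟩
  have hCne : C.Nonempty := by
    obtain ⟨a, hak, hal, hpa, haq⟩ := h.exists_between k l p hpk q hql hpq
    exact ⟨a, mem_C a hak hal hpa haq⟩
  have hCc : IsCompact C := by
    refine isCompact_iff_ultrafilter_le_nhds'.2 fun u hu => ?_
    obtain ⟨x, hx, hux⟩ := ((hW.isPatch k).isCompact.inter (hW.isPatch l).isCompact
      ).ultrafilter_le_nhds' u (Filter.mem_of_superset hu fun a ha => ha.1)
    have huC : ∀ᶠ a in (u : Filter Y), a ∈ C := hu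
    refine ⟨x, ⟨hx, ?_, ?_⟩, hux⟩
    · refine (hW.isPatch k).causal_of_frequently p hpK x hx.1 ?_
      have ht : Filter.Tendsto (fun a => (p, a)) u (𝓝[K k ×ˢ K k] (p, x)) :=
        tendsto_nhdsWithin_iff.2 ⟨tendsto_const_nhds.prodMk_nhds hux,
          huC.mono fun a ha => ⟨hpK, ha.1.1⟩⟩
      exact ht.frequently (huC.mono fun a ha => ha.2.1).frequently
    · refine (hW.isPatch l).causal_of_frequently x hx.2 q hqK ?_
      have ht : Filter.Tendsto (fun a => (a, q)) u (𝓝[K l ×ˢ K l] (x, q)) :=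
        tendsto_nhdsWithin_iff.2
          ⟨Filter.Tendsto.prodMk_nhds (show Filter.Tendsto (fun a => a) u (𝓝 x) from hux)
            tendsto_const_nhds,
            huC.mono fun a ha => ⟨ha.1.2, hqK⟩⟩
      exact ht.frequently (huC.mono fun a ha => ha.2.2).frequently
  have hcont : ContinuousOn (fun a => T.tau p a + T.tau a q) C :=
    ((hW.isPatch k).continuousOn_tau.comp (f := fun a => (p, a)) (by fun_prop)
      fun a ha => ⟨hpK, ha.1.1⟩).add
    ((hW.isPatch l).continuousOn_tau.comp (f := fun a => (a, q)) (by fun_prop)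
      fun a ha => ⟨ha.1.2, hqK⟩)
  obtain ⟨a, ha, hmax⟩ := hCc.exists_isMaxOn hCne hcont
  refine ⟨a, ha.1.1, ha.1.2, ha.2.1, ha.2.2, le_of_not_gt fun hlt => ?_⟩
  obtain ⟨b, hbk, hbl, hpb, hbq, hb⟩ := h.exists_tau_between k l p hpk q hql _ hlt
  exact absurd (hmax (mem_C b hbk hbl hpb hbq)) (not_le.2 hb)

theorem tau_ne_top {p q : Y} (hp : p ∈ W) (hq : q ∈ W) : T.tau p q ≠ ∞ := by
  by_cases hpq : T.causal p q
  · obtain ⟨k, hk⟩ := h.cover p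
    obtain ⟨l, hl⟩ := h.cover q
    obtain ⟨a, hak, hal, _, _, hle⟩ := h.exists_tau_le_add hW hp hq hk hl hpq
    exact ne_top_of_le_ne_top (ENNReal.add_ne_top.2
      ⟨(hW.isPatch k).tau_ne_top _ (hW.inter_subset k p hp hk) _ hak,
        (hW.isPatch l).tau_ne_top _ hal _ (hW.inter_subset l q hq hl)⟩) hle
  · simp [h.tau_eq_zero hpq]

/-- Gives closedness of `≤` and upper semicontinuity of `τ` at once. Optimal crossing points
converge along the ultrafilter by compactness of the patches; causality passes to the limit, and `τ`
tends to `τ(p, x) + τ(x, q)`, which is at most `τ(p, q)`. -/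
theorem exists_tendsto_tau {p q : Y} (hp : p ∈ W) (hq : q ∈ W) (u : Ultrafilter (Y × Y))
    (hu : ↑u ≤ 𝓝 (p, q)) (huc : ∀ᶠ r in (u : Filter (Y × Y)), T.causal r.1 r.2) :
    T.causal p q ∧ ∃ t ≤ T.tau p q,
      Filter.Tendsto (fun r : Y × Y => T.tau r.1 r.2) u (𝓝 t) := by
  have := h.t2Space
  have hu₁ : Filter.Tendsto Prod.fst (u : Filter (Y × Y)) (𝓝 p) :=
    continuous_fst.continuousAt.mono_left hu
  have hu₂ : Filter.Tendsto Prod.snd (u : Filter (Y × Y)) (𝓝 q) :=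
    continuous_snd.continuousAt.mono_left hu
  have hW₁ := hu₁.eventually (hW.isOpen.mem_nhds hp)
  have hW₂ := hu₂.eventually (hW.isOpen.mem_nhds hq)
  -- An ultrafilter decides between two alternatives, so each coordinate eventually stays in a
  -- single piece.
  have piece : ∀ (g : Y × Y → Y), ∃ k, ∀ᶠ r in (u : Filter (Y × Y)), g r ∈ Z k := by
    intro g
    have : ∀ᶠ r in (u : Filter (Y × Y)), g r ∈ Z true ∨ g r ∈ Z false :=
      Filter.Eventually.of_forall fun r => by
        obtain ⟨k, hk⟩ := h.cover (g r)
        cases k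
        · exact Or.inr hk
        · exact Or.inl hk
    rcases Ultrafilter.eventually_or.1 this with h' | h'
    exacts [⟨_, h'⟩, ⟨_, h'⟩]
  obtain ⟨k, hk⟩ := piece Prod.fst
  obtain ⟨l, hl⟩ := piece Prod.snd
  have hpK : p ∈ K k := hW.inter_subset k p hp ((h.isClosed k).mem_of_tendsto hu₁ hk)
  have hqK : q ∈ K l := hW.inter_subset l q hq ((h.isClosed l).mem_of_tendsto hu₂ hl)
  have hex : ∀ᶠ r in (u : Filter (Y × Y)), ∃ a, a ∈ K k ∧ a ∈ K l ∧ T.causal r.1 a ∧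
      T.causal a r.2 ∧ T.tau r.1 r.2 ≤ T.tau r.1 a + T.tau a r.2 := by
    filter_upwards [hW₁, hW₂, hk, hl, huc] with r h₁ h₂ h₃ h₄ h₅
      using h.exists_tau_le_add hW h₁ h₂ h₃ h₄ h₅
  have : Nonempty Y := ⟨p⟩
  obtain ⟨a, ha⟩ := hex.choice
  obtain ⟨x, hx, hux⟩ := ((hW.isPatch k).isCompact.inter (hW.isPatch l).isCompact
    ).ultrafilter_le_nhds' (u.map a) (ha.mono fun r hr => ⟨hr.1, hr.2.1⟩)
  replace hux : Filter.Tendsto a u (𝓝 x) := hux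
  have ht₁ : Filter.Tendsto (fun r : Y × Y => (r.1, a r)) u (𝓝[K k ×ˢ K k] (p, x)) := by
    refine tendsto_nhdsWithin_iff.2 ⟨hu₁.prodMk_nhds hux, ?_⟩
    filter_upwards [hW₁, hk, ha] with r h₁ h₂ h₃ using ⟨hW.inter_subset k _ h₁ h₂, h₃.1⟩
  have ht₂ : Filter.Tendsto (fun r : Y × Y => (a r, r.2)) u (𝓝[K l ×ˢ K l] (x, q)) := by
    refine tendsto_nhdsWithin_iff.2 ⟨hux.prodMk_nhds hu₂, ?_⟩
    filter_upwards [hW₂, hl, ha] with r h₁ h₂ h₃ using ⟨h₃.2.1, hW.inter_subset l _ h₁ h₂⟩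
  have hpx : T.causal p x := (hW.isPatch k).causal_of_frequently p hpK x hx.1
    (ht₁.frequently (ha.mono fun r hr => hr.2.2.1).frequently)
  have hxq : T.causal x q := (hW.isPatch l).causal_of_frequently x hx.2 q hqK
    (ht₂.frequently (ha.mono fun r hr => hr.2.2.2.1).frequently)
  refine ⟨h.causal_trans _ _ _ hpx hxq, _, h.tau_add_le _ _ _ hpx hxq, ?_⟩
  refine Filter.Tendsto.congr' ?_
    ((((hW.isPatch k).continuousOn_tau (p, x) ⟨hpK, hx.1⟩).tendsto.comp ht₁).add
      (((hW.isPatch l).continuousOn_tau (x, q) ⟨hx.2, hqK⟩).tendsto.comp ht₂))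
  filter_upwards [ha] with r hr
    using le_antisymm (h.tau_add_le _ _ _ hr.2.2.1 hr.2.2.2.1) hr.2.2.2.2

/-- Along an ultrafilter of causal pairs, the upper bound of `exists_tendsto_tau` meets lower
semicontinuity. Otherwise `τ` is eventually zero, and lower semicontinuity forces `τ(p, q) = 0`. -/
theorem continuousAt_tau {p q : Y} (hp : p ∈ W) (hq : q ∈ W) :
    ContinuousAt (fun r : Y × Y => T.tau r.1 r.2) (p, q) := by
  refine continuousAt_iff_ultrafilter.2 fun u hu => ?_
  have hlsc : ∀ c < T.tau p q, ∀ᶠ r in (u : Filter (Y × Y)), c < T.tau r.1 r.2 := fun c hc =>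
    hu (h.lowerSemicontinuous_tau (p, q) c hc)
  rcases u.em fun r => T.causal r.1 r.2 with huc | huc
  · obtain ⟨-, t, ht, htend⟩ := h.exists_tendsto_tau hW hp hq u hu huc
    convert htend
    exact le_antisymm (le_of_forall_lt_imp_le_of_dense fun c hc =>
      ge_of_tendsto htend ((hlsc c hc).mono fun _ => le_of_lt)) ht
  · have h0 : ∀ᶠ r in (u : Filter (Y × Y)), 0 = T.tau r.1 r.2 :=
      huc.mono fun r hr => (h.tau_eq_zero hr).symm
    have : T.tau p q = 0 := by
      by_contra hne
      obtain ⟨r, hr₁, hr₂⟩ := (h0.and (hlsc 0 (pos_iff_ne_zero.2 hne))).exists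
      exact hr₂.ne hr₁
    rw [this]
    exact tendsto_const_nhds.congr' h0

theorem exists_maximal {p q : Y} (hp : p ∈ W) (hq : q ∈ W) (hpq : T.causal p q) :
    ∃ (a b : ℝ) (γ : ℝ → Y), T.IsCausalCurveFromToIn W p q a b γ ∧
      T.tau p q ≤ T.tauLength a b γ := by
  obtain ⟨k, hk⟩ := h.cover p
  obtain ⟨l, hl⟩ := h.cover q
  obtain ⟨x, hxk, hxl, hpx, hxq, hle⟩ := h.exists_tau_le_add hW hp hq hk hl hpq
  obtain ⟨a₁, b₁, γ₁, hγ₁, hs₁, ht₁, hl₁⟩ :=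
    (hW.isPatch k).exists_maximal p (hW.inter_subset k p hp hk) x hxk hpx
  obtain ⟨a₂, b₂, γ₂, hγ₂, hs₂, ht₂, hl₂⟩ :=
    (hW.isPatch l).exists_maximal x hxl q (hW.inter_subset l q hq hl) hxq
  obtain ⟨c, ρ, hρ, hs, ht, hL, -⟩ :=
    exists_causalCurve_concat h.causal_trans h.tau_add_le hγ₁ hγ₂ (ht₁.trans hs₂.symm)
  have hs' := hs.trans hs₁
  have ht' := ht.trans ht₂
  refine ⟨a₁, c, ρ, ⟨hρ, hs', ht', fun t ht => hW.convex p hp q hq _ ?_ ?_⟩,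
    hle.trans ((add_le_add hl₁ hl₂).trans hL)⟩
  · rcases ht.1.eq_or_lt with rfl | hlt
    · rw [hs']; exact h.causal_refl p
    · rw [← hs']; exact hρ.causal _ ⟨le_rfl, hρ.lt.le⟩ _ ht hlt
  · rcases ht.2.eq_or_lt with rfl | hlt
    · rw [ht']; exact h.causal_refl q
    · rw [← ht']; exact hρ.causal _ ht _ ⟨hρ.lt.le, le_rfl⟩ hlt

/-- The times spent in the two pieces form closed sets covering `[a, b]`, and the variation over
each is bounded by its patch. The displacement over a cell is at most the sum of the two variations
within that cell, and these add up over a subdivision. -/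
theorem exists_length_bound : ∃ C : ℝ≥0, ∀ (a b : ℝ) (γ : ℝ → Y), T.IsCausalCurve a b γ →
    Set.MapsTo γ (Set.Icc a b) W → eVariationOn γ (Set.Icc a b) ≤ C := by
  choose C hC using fun k => (hW.isPatch k).exists_variation_bound
  refine ⟨C true + C false, fun a b γ hγ hmap => ?_⟩
  have hcont := hγ.locallyLipschitz.continuousOn
  set s : Bool → Set ℝ := fun k => Set.Icc a b ∩ γ ⁻¹' Z k with hs_def
  have hs : ∀ k, IsClosed (s k) := fun k => hcont.preimage_isClosed_of_isClosed isClosed_Icc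
    (h.isClosed k)
  have hvar : ∀ k, eVariationOn γ (s k) ≤ C k := fun k => hC k γ (s k)
    (fun t ht => hW.inter_subset k _ (hmap ht.1) ht.2)
    fun x hx y hy hxy => hγ.causal x hx.1 y hy.1 hxy
  have hcov : ∀ t ∈ Set.Icc a b, t ∈ s true ∨ t ∈ s false := by
    intro t ht
    obtain ⟨k, hk⟩ := h.cover (γ t)
    cases k
    · exact Or.inr ⟨ht, hk⟩
    · exact Or.inl ⟨ht, hk⟩
  have hstep : ∀ x ∈ Set.Icc a b, ∀ y ∈ Set.Icc a b, x ≤ y → edist (γ y) (γ x) ≤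
      eVariationOn γ (s true ∩ Set.Icc x y) + eVariationOn γ (s false ∩ Set.Icc x y) := by
    intro x hx y hy hxy
    have same : ∀ k, ∀ x' ∈ Set.Icc x y, ∀ y' ∈ Set.Icc x y, x' ∈ s k → y' ∈ s k →
        edist (γ y') (γ x') ≤ eVariationOn γ (s k ∩ Set.Icc x y) := fun k x' hx' y' hy' hxk hyk =>
      eVariationOn.edist_le γ ⟨hyk, hy'⟩ ⟨hxk, hx'⟩
    have hl : x ∈ Set.Icc x y := ⟨le_rfl, hxy⟩
    have hr : y ∈ Set.Icc x y := ⟨hxy, le_rfl⟩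
    -- If the ends of the cell lie in no common piece, connectedness of the interval supplies a time
    -- in both closed sets, at which the displacement can be split.
    obtain ⟨z, hz, hzt, hzf⟩ | ⟨k, hxk, hyk⟩ : (∃ z ∈ Set.Icc x y, z ∈ s true ∧ z ∈ s false) ∨
        ∃ k, x ∈ s k ∧ y ∈ s k := by
      by_contra! hcon
      have hpre := isPreconnected_closed_iff.1 (isPreconnected_Icc (a := x) (b := y)) _ _
        (hs true) (hs false) fun t ht => hcov t ⟨hx.1.trans ht.1, ht.2.trans hy.2⟩
      have hne : (Set.Icc x y ∩ s true).Nonempty ∧ (Set.Icc x y ∩ s false).Nonempty := by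
        rcases hcov x hx with h₁ | h₁ <;> rcases hcov y hy with h₂ | h₂
        · exact absurd h₂ (hcon.2 _ h₁)
        · exact ⟨⟨x, hl, h₁⟩, ⟨y, hr, h₂⟩⟩
        · exact ⟨⟨y, hr, h₂⟩, ⟨x, hl, h₁⟩⟩
        · exact absurd h₂ (hcon.2 _ h₁)
      obtain ⟨z, hz, hzt, hzf⟩ := hpre hne.1 hne.2
      exact hcon.1 z hz hzt hzf
    · have hzx : ∀ k, z ∈ s k := by rintro (_ | _) <;> assumption
      rcases hcov x hx with h₁ | h₁ <;> rcases hcov y hy with h₂ | h₂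
      · exact (same true x hl y hr h₁ h₂).trans le_self_add
      · refine (edist_triangle _ (γ z) _).trans ?_
        rw [add_comm]
        exact add_le_add (same true x hl z hz h₁ hzt) (same false z hz y hr hzf h₂)
      · refine (edist_triangle _ (γ z) _).trans ?_
        exact add_le_add (same true z hz y hr hzt h₂) (same false x hl z hz h₁ hzf)
      · exact (same false x hl y hr h₁ h₂).trans le_add_self
    · cases k
      · exact (same false x hl y hr hxk hyk).trans le_add_self
      · exact (same true x hl y hr hxk hyk).trans le_self_add
  refine iSup_le fun ⟨n, u, hu, hus⟩ => ?_
  calc ∑ i ∈ Finset.range n, edist (γ (u (i + 1))) (γ (u i))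
      ≤ ∑ i ∈ Finset.range n, (eVariationOn γ (s true ∩ Set.Icc (u i) (u (i + 1))) +
        eVariationOn γ (s false ∩ Set.Icc (u i) (u (i + 1)))) :=
        Finset.sum_le_sum fun i _ => hstep _ (hus _) _ (hus _) (hu i.le_succ)
    _ ≤ eVariationOn γ (s true) + eVariationOn γ (s false) := by
        rw [Finset.sum_add_distrib]
        exact add_le_add
          ((eVariationOn.sum_inter_Icc_le γ _ hu n).trans
            (eVariationOn.mono γ Set.inter_subset_left))
          ((eVariationOn.sum_inter_Icc_le γ _ hu n).trans
            (eVariationOn.mono γ Set.inter_subset_left))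
    _ ≤ (C true + C false : ℝ≥0) := by
        push_cast
        exact add_le_add (hvar true) (hvar false)

/-- With `ω` the restriction of `τ`, maximality is automatic for a curve of length `τ(p, q)`, since
`L_τ` never exceeds `τ` of the endpoints. -/
theorem isLocalizableSet : T.IsLocalizableSet W := by
  refine ⟨h.exists_length_bound hW, fun r => (T.tau r.1 r.2).toNNReal, ?_, ?_, ?_, ?_⟩
  · refine continuous_iff_continuousAt.2 fun r => ?_
    refine (ENNReal.tendsto_toNNReal (h.tau_ne_top hW r.1.2 r.2.2)).comp ?_
    exact (h.continuousAt_tau hW r.1.2 r.2.2).comp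
      (f := fun r : W × W => ((r.1 : Y), (r.2 : Y))) (x := r) (by fun_prop)
  · have htau : ∀ p q : W, (T.restrictWith W fun r => (T.tau r.1 r.2).toNNReal).tau p q =
        T.tau p q := fun p q => ENNReal.coe_toNNReal (h.tau_ne_top hW p.2 q.2)
    refine ⟨fun x y hxy => Subtype.ext (h.eq_of_edist_eq_zero _ _ hxy), fun x => h.causal_refl x,
      fun x y z => h.causal_trans x y z, fun x y z => h.chron_trans x y z,
      fun x y => h.causal_of_chron x y, ?_, fun x y z hxy hyz => ?_, fun x y => ?_⟩
    · simp only [htau]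
      exact h.lowerSemicontinuous_tau.comp
        (g := fun r : W × W => ((r.1 : Y), (r.2 : Y))) (by fun_prop)
    · simp only [htau]
      exact h.tau_add_le _ _ _ hxy hyz
    · rw [htau]
      exact h.tau_pos_iff _ _
  · intro p hp
    obtain ⟨b, hb, hpb, -⟩ := h.exists_future p W (hW.isOpen.mem_nhds hp)
    obtain ⟨c, hc, hcp, -⟩ := h.exists_past p W (hW.isOpen.mem_nhds hp)
    exact ⟨⟨b, hpb, hb⟩, c, hcp, hc⟩
  · intro p q hpq
    obtain ⟨a, b, γ, hγ, hle⟩ := h.exists_maximal hW p.2 q.2 hpq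
    have hmax : ∀ (a' b' : ℝ) (σ : ℝ → Y), T.IsCausalCurveFromToIn W p q a' b' σ →
        T.tauLength a' b' σ ≤ T.tau p q := fun a' b' σ hσ => by
      have := tauLength_le_tau (S := T) hσ.lt σ
      rwa [hσ.source, hσ.target] at this
    refine ⟨a, b, γ, hγ, fun a' b' σ hσ => (hmax a' b' σ hσ).trans hle, ?_⟩
    rw [ENNReal.coe_toNNReal (h.tau_ne_top hW p.2 q.2)]
    exact le_antisymm (hmax a b γ hγ) hle

omit hW

theorem stronglyLocalizable : T.StronglyLocalizable := by
  intro x V hV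
  obtain ⟨K, W, hW, hx, hWV⟩ := h.exists_isPatched x V hV
  exact ⟨W, hW.isOpen.mem_nhds hx, hWV, h.isLocalizableSet hW⟩

/-- Regularity gives a closed neighbourhood inside `W`, so that its closure is still covered by
`exists_tendsto_tau`. -/
theorem locallyCausallyClosed : T.LocallyCausallyClosed := by
  intro x
  obtain ⟨K, W, hW, hx, -⟩ := h.exists_isPatched x Set.univ Filter.univ_mem
  obtain ⟨U, hU, hUc, hUW⟩ := exists_mem_nhds_isClosed_subset (hW.isOpen.mem_nhds hx)
  refine ⟨U, hU, isClosed_iff_ultrafilter.2 fun r u hu hmem => ?_⟩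
  have hcl : ∀ p : closure U, (p : Y) ∈ W := fun p => hUW (hUc.closure_subset p.2)
  have hcont : Continuous fun r : closure U × closure U => ((r.1 : Y), (r.2 : Y)) := by fun_prop
  exact (h.exists_tendsto_tau hW (hcl r.1) (hcl r.2)
    (u.map fun r : closure U × closure U => ((r.1 : Y), (r.2 : Y)))
    ((hcont.tendsto r).mono_left hu) hmem).1

theorem isLengthSpace : T.IsLengthSpace :=
  ⟨h.isPreLengthSpace, h.locallyCausallyClosed, h.causallyPathConnected, fun x => by
    obtain ⟨U, hU, -, hloc⟩ := h.stronglyLocalizable x Set.univ Filter.univ_mem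
    exact ⟨U, hU, hloc⟩, h.intrinsic⟩

end IsGluedFrom

end LorentzianStructure

/-! ### Diamonds and local time separation in a single length space -/

namespace LorentzianStructure

section LengthSpace

variable {X : Type*} [PseudoEMetricSpace X] {S : LorentzianStructure X}

theorem IsTimelikeCurve.eventually_left {a b : ℝ} {γ : ℝ → X} (hγ : S.IsTimelikeCurve a b γ)
    {U : Set X} (hU : U ∈ 𝓝 (γ a)) : ∃ t ∈ Set.Ioc a b, γ t ∈ U := by
  have hlt := hγ.lt
  have hc : Filter.Tendsto γ (𝓝[Set.Icc a b] a) (𝓝 (γ a)) :=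
    hγ.locallyLipschitz.continuousOn a ⟨le_rfl, hlt.le⟩
  have h₁ : ∀ᶠ t in 𝓝[>] a, γ t ∈ U ∧ t ∈ Set.Ioc a b := by
    rw [← nhdsWithin_Ioc_eq_nhdsGT hlt]
    exact Filter.inter_mem (nhdsWithin_mono a Set.Ioc_subset_Icc_self (hc hU)) self_mem_nhdsWithin
  obtain ⟨t, ht, hta⟩ := h₁.exists
  exact ⟨t, hta, ht⟩

theorem IsTimelikeCurve.eventually_right {a b : ℝ} {γ : ℝ → X} (hγ : S.IsTimelikeCurve a b γ)
    {U : Set X} (hU : U ∈ 𝓝 (γ b)) : ∃ t ∈ Set.Ico a b, γ t ∈ U := by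
  have hlt := hγ.lt
  have hc : Filter.Tendsto γ (𝓝[Set.Icc a b] b) (𝓝 (γ b)) :=
    hγ.locallyLipschitz.continuousOn b ⟨hlt.le, le_rfl⟩
  have h₁ : ∀ᶠ t in 𝓝[<] b, γ t ∈ U ∧ t ∈ Set.Ico a b := by
    rw [← nhdsWithin_Ico_eq_nhdsLT hlt]
    exact Filter.inter_mem (nhdsWithin_mono b Set.Ico_subset_Icc_self (hc hU)) self_mem_nhdsWithin
  obtain ⟨t, ht, hta⟩ := h₁.exists
  exact ⟨t, hta, ht⟩

theorem IsCausalCurve.mapsTo_diamond (hS : S.IsAlgebraic) {a b : ℝ}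
    {γ : ℝ → X} (hγ : S.IsCausalCurve a b γ) {u v : X} (ha : γ a ∈ S.diamond u v)
    (hb : γ b ∈ S.diamond u v) : Set.MapsTo γ (Set.Icc a b) (S.diamond u v) := by
  intro t ht
  refine hS.diamond_convex ha hb ?_ ?_
  · rcases ht.1.eq_or_lt with rfl | hlt
    · exact hS.causal_refl _
    · exact hγ.causal _ ⟨le_rfl, hγ.lt.le⟩ _ ht hlt
  · rcases ht.2.eq_or_lt with rfl | hlt
    · exact hS.causal_refl _
    · exact hγ.causal _ ht _ ⟨hγ.lt.le, le_rfl⟩ hlt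

namespace IsLengthSpace

variable (hS : S.IsLengthSpace)
include hS

/-- Localizability makes the timelike future nonempty, and a timelike curve leaving `x` has points
of that future arbitrarily close to `x`. -/
theorem exists_future (x : X) (U : Set X) (hU : U ∈ 𝓝 x) : ∃ b ∈ U, S.chron x b := by
  obtain ⟨Ω, hΩ, hloc⟩ := hS.localizable x
  obtain ⟨_, _, _, hne, _⟩ := hloc.exists_omega
  obtain ⟨y, hxy, -⟩ := (hne x (mem_of_mem_nhds hΩ)).1
  obtain ⟨a, b, γ, hγ, rfl, -⟩ := hS.causallyPathConnected.1 x y hxy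
  obtain ⟨t, ht, htU⟩ := hγ.eventually_left hU
  exact ⟨_, htU, hγ.chron _ ⟨le_rfl, hγ.lt.le⟩ _ ⟨ht.1.le, ht.2⟩ ht.1⟩

theorem exists_past (x : X) (U : Set X) (hU : U ∈ 𝓝 x) : ∃ b ∈ U, S.chron b x := by
  obtain ⟨Ω, hΩ, hloc⟩ := hS.localizable x
  obtain ⟨_, _, _, hne, _⟩ := hloc.exists_omega
  obtain ⟨y, hxy, -⟩ := (hne x (mem_of_mem_nhds hΩ)).2
  obtain ⟨a, b, γ, hγ, -, rfl⟩ := hS.causallyPathConnected.1 y x hxy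
  obtain ⟨t, ht, htU⟩ := hγ.eventually_right hU
  exact ⟨_, htU, hγ.chron _ ⟨ht.1, ht.2.le⟩ _ ⟨hγ.lt.le, le_rfl⟩ ht.2⟩

/-- In a strongly causal Lorentzian length space, the timelike diamonds form a basis. -/
theorem exists_diamond (hsc : S.StronglyCausal) (x : X) (V : Set X) (hV : V ∈ 𝓝 x) :
    ∃ u v, x ∈ S.diamond u v ∧ S.diamond u v ⊆ V := by
  have hnhds : 𝓝 x = ⨅ s ∈ {s | x ∈ s ∧ s ∈ {I | ∃ x y : X, I = S.diamond x y}},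
      Filter.principal s := by
    rw [← TopologicalSpace.nhds_generateFrom]
    conv_lhs => rw [hsc]
  rw [hnhds, Filter.mem_biInf_of_directed] at hV
  · obtain ⟨_, ⟨hx, u, v, rfl⟩, hs⟩ := hV
    exact ⟨u, v, hx, hs⟩
  · rintro _ ⟨hx₁, u₁, v₁, rfl⟩ _ ⟨hx₂, u₂, v₂, rfl⟩
    have hopen : ∀ {u v}, x ∈ S.diamond u v → S.diamond u v ∈ 𝓝 x := fun {u v} hx =>
      (hS.isOpen_diamond u v).mem_nhds hx
    -- The subbasis is a basis at `x`: moving both endpoints into two given diamonds yields a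
    -- diamond contained in both.
    obtain ⟨u, hu, hux⟩ := hS.exists_past x _ (Filter.inter_mem (hopen hx₁) (hopen hx₂))
    obtain ⟨v, hv, hxv⟩ := hS.exists_future x _ (Filter.inter_mem (hopen hx₁) (hopen hx₂))
    refine ⟨S.diamond u v, ⟨⟨hux, hxv⟩, u, v, rfl⟩, ?_, ?_⟩
    · exact Filter.principal_mono.2 fun z hz => ⟨hS.chron_trans _ _ _ hu.1.1 hz.1,
        hS.chron_trans _ _ _ hz.2 hv.1.2⟩
    · exact Filter.principal_mono.2 fun z hz => ⟨hS.chron_trans _ _ _ hu.2.1 hz.1,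
        hS.chron_trans _ _ _ hz.2 hv.2.2⟩
  · obtain ⟨u, -, hux⟩ := hS.exists_past x Set.univ Filter.univ_mem
    obtain ⟨v, -, hxv⟩ := hS.exists_future x Set.univ Filter.univ_mem
    exact ⟨S.diamond u v, ⟨hux, hxv⟩, u, v, rfl⟩

/-- Finite causal chains are refined by causal curves. -/
theorem exists_causalCurve_chain (x : ℕ → X) (n : ℕ) (hx : ∀ i < n, S.causal (x i) (x (i + 1))) :
    ∃ (a b : ℝ) (γ : ℝ → X), S.IsCausalCurve a b γ ∧ γ a = x 0 ∧ γ b = x n ∧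
      ∑ i ∈ Finset.range n, edist (x i) (x (i + 1)) ≤ eVariationOn γ (Set.Icc a b) := by
  induction n with
  | zero =>
    obtain ⟨a, b, γ, hγ, hs, ht⟩ := hS.causallyPathConnected.2 _ _ (hS.causal_refl (x 0))
    exact ⟨a, b, γ, hγ, hs, ht, by simp⟩
  | succ n ih =>
    obtain ⟨a, b, γ, hγ, hs, ht, hle⟩ := ih fun i hi => hx i (by omega)
    obtain ⟨a', b', σ, hσ, hs', ht'⟩ := hS.causallyPathConnected.2 _ _ (hx n n.lt_succ_self)
    obtain ⟨c, ρ, hρ, hs'', ht'', -, hv⟩ :=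
      exists_causalCurve_concat hS.causal_trans hS.tau_add_le hγ hσ (ht.trans hs'.symm)
    refine ⟨a, c, ρ, hρ, hs''.trans hs, ht''.trans ht', ?_⟩
    rw [Finset.sum_range_succ]
    refine le_trans ?_ hv
    rw [hs', ht']
    gcongr

/-- On a timelike diamond in a localizable set, the local time separation agrees with the global
one. -/
theorem exists_omega_eq_tau {Ω : Set X} (hΩ : S.IsLocalizableSet Ω) {u v : X}
    (hsub : S.diamond u v ⊆ Ω) :
    ContinuousOn (fun r : X × X => S.tau r.1 r.2) (S.diamond u v ×ˢ S.diamond u v) ∧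
    (∀ p ∈ S.diamond u v, ∀ q ∈ S.diamond u v, S.tau p q ≠ ∞) ∧
    ∀ p ∈ S.diamond u v, ∀ q ∈ S.diamond u v, S.causal p q → ∃ (a b : ℝ) (γ : ℝ → X),
      S.IsCausalCurve a b γ ∧ γ a = p ∧ γ b = q ∧ S.tau p q ≤ S.tauLength a b γ := by
  obtain ⟨ω, hω, hpre, -, hmax⟩ := hΩ.exists_omega
  have hSa := hS.toIsPreLengthSpace.isAlgebraic
  have key : ∀ (p q : X) (hp : p ∈ S.diamond u v) (hq : q ∈ S.diamond u v), S.causal p q →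
      ∃ (a b : ℝ) (γ : ℝ → X), S.IsCausalCurve a b γ ∧ γ a = p ∧ γ b = q ∧
        S.tau p q ≤ S.tauLength a b γ ∧ S.tau p q = ω (⟨p, hsub hp⟩, ⟨q, hsub hq⟩) := by
    intro p q hp hq hpq
    obtain ⟨a, b, γ, hγ, hγmax, hγω⟩ := hmax ⟨p, hsub hp⟩ ⟨q, hsub hq⟩ hpq
    have hle : S.tau p q ≤ S.tauLength a b γ := by
      -- Every causal curve from `p` to `q` stays in the convex diamond, hence in `Ω`, so the
      -- maximizer in `Ω` is a global maximizer.
      rw [hS.intrinsic p q]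
      refine iSup_le fun a' => iSup_le fun b' => iSup_le fun σ => iSup_le fun hσ => ?_
      refine hγmax a' b' σ ⟨hσ.1, hσ.2.1, hσ.2.2, ?_⟩
      refine (hσ.1.mapsTo_diamond hSa ?_ ?_).mono_right hsub
      · rwa [hσ.2.1]
      · rwa [hσ.2.2]
    refine ⟨a, b, γ, hγ.toIsCausalCurve, hγ.source, hγ.target, hle, ?_⟩
    rw [← hγω]
    refine le_antisymm hle ?_
    have := tauLength_le_tau (S := S) hγ.lt γ
    rwa [hγ.source, hγ.target] at this
  have heq : ∀ (p q : X) (hp : p ∈ S.diamond u v) (hq : q ∈ S.diamond u v),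
      S.tau p q = ω (⟨p, hsub hp⟩, ⟨q, hsub hq⟩) := by
    intro p q hp hq
    by_cases hpq : S.causal p q
    · obtain ⟨a, b, γ, -, -, -, -, h⟩ := key p q hp hq hpq
      exact h
    · rw [hSa.tau_eq_zero hpq]
      exact (hpre.isAlgebraic.tau_eq_zero (p := ⟨p, hsub hp⟩) (q := ⟨q, hsub hq⟩) hpq).symm
  refine ⟨?_, fun p hp q hq => ?_, fun p hp q hq hpq => ?_⟩
  · rw [continuousOn_iff_continuous_domRestrict]
    have hc : Continuous fun r : ↥(S.diamond u v ×ˢ S.diamond u v) =>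
        (ω (⟨r.1.1, hsub r.2.1⟩, ⟨r.1.2, hsub r.2.2⟩) : ℝ≥0∞) :=
      ENNReal.continuous_coe.comp (hω.comp (by fun_prop))
    convert hc using 1
    ext r
    exact heq _ _ r.2.1 r.2.2
  · rw [heq p q hp hq]
    exact ENNReal.coe_ne_top
  · obtain ⟨a, b, γ, h₁, h₂, h₃, h₄, -⟩ := key p q hp hq hpq
    exact ⟨a, b, γ, h₁, h₂, h₃, h₄⟩

end IsLengthSpace

theorem CausallyClosed.causal_of_frequently {U : Set X} (h : S.CausallyClosed U) {p q : X}
    (hp : p ∈ closure U) (hq : q ∈ closure U)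
    (hf : ∃ᶠ r in 𝓝[closure U ×ˢ closure U] (p, q), S.causal r.1 r.2) : S.causal p q := by
  have : ((⟨p, hp⟩, ⟨q, hq⟩) : closure U × closure U) ∈
      {p : closure U × closure U | S.causal p.1 p.2} := by
    refine IsClosed.mem_of_frequently_of_tendsto h
      (b := 𝓝 ((⟨p, hp⟩, ⟨q, hq⟩) : closure U × closure U)) ?_ Filter.tendsto_id
    rw [nhdsWithin_prod_eq, ← map_nhds_subtype_val ⟨p, hp⟩, ← map_nhds_subtype_val ⟨q, hq⟩,
      Filter.prod_map_map_eq, Filter.frequently_map, ← nhds_prod_eq] at hf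
    exact hf
  exact this

end LengthSpace

/-! ### Transfer of the length space properties to an embedded piece -/

/-- A map that is an embedding of Lorentzian structures and of topological spaces and does not
increase distances. -/
structure IsPieceEmbedding {X Y : Type*} [PseudoEMetricSpace X] [PseudoEMetricSpace Y]
    (S : LorentzianStructure X) (T : LorentzianStructure Y) (i : X → Y) : Prop where
  lipschitzWith : LipschitzWith 1 i
  isEmbedding : Topology.IsEmbedding i
  causal_iff : ∀ x y, T.causal (i x) (i y) ↔ S.causal x y
  chron_iff : ∀ x y, T.chron (i x) (i y) ↔ S.chron x y
  tau_eq : ∀ x y, T.tau (i x) (i y) = S.tau x y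

namespace IsPieceEmbedding

variable {X Y : Type*} [PseudoEMetricSpace X] [PseudoEMetricSpace Y] {S : LorentzianStructure X}
  {T : LorentzianStructure Y} {i : X → Y} (hi : S.IsPieceEmbedding T i)
include hi

theorem map_causalCurve {a b : ℝ} {γ : ℝ → X} (hγ : S.IsCausalCurve a b γ) :
    T.IsCausalCurve a b (i ∘ γ) :=
  ⟨hγ.lt, locallyLipschitzOn_comp hi.lipschitzWith hγ.locallyLipschitz,
    fun s hs t ht hst => (hi.causal_iff _ _).2 (hγ.causal s hs t ht hst)⟩

theorem map_timelikeCurve {a b : ℝ} {γ : ℝ → X} (hγ : S.IsTimelikeCurve a b γ) :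
    T.IsTimelikeCurve a b (i ∘ γ) :=
  ⟨hγ.lt, locallyLipschitzOn_comp hi.lipschitzWith hγ.locallyLipschitz,
    fun s hs t ht hst => (hi.chron_iff _ _).2 (hγ.chron s hs t ht hst)⟩

theorem tauLength_comp (a b : ℝ) (γ : ℝ → X) : T.tauLength a b (i ∘ γ) = S.tauLength a b γ := by
  simp only [tauLength, Function.comp_apply, hi.tau_eq]

theorem lsc_left (hS : S.IsPreLengthSpace) : ∀ x ∈ Set.range i, ∀ y ∈ Set.range i,
    ∀ c < T.tau x y, ∀ᶠ x' in 𝓝[Set.range i] x, c < T.tau x' y := by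
  rintro _ ⟨x, rfl⟩ _ ⟨y, rfl⟩ c hc
  rw [hi.tau_eq] at hc
  rw [← hi.isEmbedding.map_nhds_eq, Filter.eventually_map]
  simp only [hi.tau_eq]
  exact (Continuous.prodMk_left y).continuousAt.eventually
    (hS.lowerSemicontinuous_tau (x, y) c hc)

theorem lsc_right (hS : S.IsPreLengthSpace) : ∀ x ∈ Set.range i, ∀ y ∈ Set.range i,
    ∀ c < T.tau x y, ∀ᶠ y' in 𝓝[Set.range i] y, c < T.tau x y' := by
  rintro _ ⟨x, rfl⟩ _ ⟨y, rfl⟩ c hc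
  rw [hi.tau_eq] at hc
  rw [← hi.isEmbedding.map_nhds_eq, Filter.eventually_map]
  simp only [hi.tau_eq]
  exact (Continuous.prodMk_right x).continuousAt.eventually
    (hS.lowerSemicontinuous_tau (x, y) c hc)

variable (hS : S.IsLengthSpace)
include hS

theorem exists_diamond (hsc : S.StronglyCausal) : ∀ y ∈ Set.range i, ∀ V ∈ 𝓝 y,
    ∃ u ∈ Set.range i, ∃ v ∈ Set.range i, y ∈ T.diamond u v ∧
      Set.range i ∩ T.diamond u v ⊆ V := by
  rintro _ ⟨x, rfl⟩ V hV
  obtain ⟨u, v, hx, hsub⟩ := hS.exists_diamond hsc x _ (hi.isEmbedding.continuous.continuousAt hV)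
  refine ⟨_, ⟨u, rfl⟩, _, ⟨v, rfl⟩, ⟨(hi.chron_iff _ _).2 hx.1, (hi.chron_iff _ _).2 hx.2⟩, ?_⟩
  rintro _ ⟨⟨z, rfl⟩, hz₁, hz₂⟩
  exact hsub ⟨(hi.chron_iff _ _).1 hz₁, (hi.chron_iff _ _).1 hz₂⟩

theorem exists_timelike : ∀ x ∈ Set.range i, ∀ y ∈ Set.range i, T.chron x y →
    ∃ (a b : ℝ) (γ : ℝ → Y), T.IsTimelikeCurve a b γ ∧ γ a = x ∧ γ b = y := by
  rintro _ ⟨x, rfl⟩ _ ⟨y, rfl⟩ hxy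
  obtain ⟨a, b, γ, hγ, rfl, rfl⟩ := hS.causallyPathConnected.1 x y ((hi.chron_iff _ _).1 hxy)
  exact ⟨a, b, _, hi.map_timelikeCurve hγ, rfl, rfl⟩

theorem exists_causal : ∀ x ∈ Set.range i, ∀ y ∈ Set.range i, T.causal x y →
    ∃ (a b : ℝ) (γ : ℝ → Y), T.IsCausalCurve a b γ ∧ γ a = x ∧ γ b = y := by
  rintro _ ⟨x, rfl⟩ _ ⟨y, rfl⟩ hxy
  obtain ⟨a, b, γ, hγ, rfl, rfl⟩ := hS.causallyPathConnected.2 x y ((hi.causal_iff _ _).1 hxy)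
  exact ⟨a, b, _, hi.map_causalCurve hγ, rfl, rfl⟩

theorem exists_length_gt : ∀ x ∈ Set.range i, ∀ y ∈ Set.range i, ∀ c < T.tau x y,
    ∃ (a b : ℝ) (γ : ℝ → Y), T.IsCausalCurve a b γ ∧ γ a = x ∧ γ b = y ∧
      c < T.tauLength a b γ := by
  rintro _ ⟨x, rfl⟩ _ ⟨y, rfl⟩ c hc
  rw [hi.tau_eq, hS.intrinsic, curveTau] at hc
  simp only [lt_iSup_iff] at hc
  obtain ⟨a, b, γ, ⟨hγ, rfl, rfl⟩, hlt⟩ := hc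
  exact ⟨a, b, _, hi.map_causalCurve hγ, rfl, rfl, by rwa [hi.tauLength_comp]⟩

/-- The patch is the image of a compact neighbourhood inside both a causally closed set and a
diamond contained in a localizable set. The diamond supplies convexity, which keeps interpolating
causal curves where their lengths are controlled. -/
theorem exists_patch (hsc : S.StronglyCausal) [LocallyCompactSpace X]
    (hcl : IsClosed (Set.range i)) (y : Y) :
    ∃ K, T.IsPatch (Set.range i) K ∧ ∀ᶠ z in 𝓝 y, z ∈ Set.range i → z ∈ K := by
  by_cases hy : y ∈ Set.range i
  swap
  -- Away from the closed piece the empty patch suffices.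
  · refine ⟨∅, ⟨by simp, by simp, by simp, by simp, by simp, ⟨0, ?_⟩, by simp⟩, ?_⟩
    · intro g s hg _
      have : s = ∅ := Set.eq_empty_of_forall_notMem fun x hx => hg hx
      simp [this]
    · filter_upwards [hcl.isOpen_compl.mem_nhds hy] with z hz hz' using absurd hz' hz
  obtain ⟨x, rfl⟩ := hy
  obtain ⟨Ω, hΩ, hloc⟩ := hS.localizable x
  obtain ⟨N, hN, hNc⟩ := hS.locallyCausallyClosed x
  obtain ⟨u, v, hx, hsub⟩ := hS.exists_diamond hsc x Ω hΩ
  obtain ⟨K, hK, hKsub, hKc⟩ := local_compact_nhds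
    (Filter.inter_mem ((hS.isOpen_diamond u v).mem_nhds hx) hN)
  obtain ⟨hcont, hfin, hmax⟩ := hS.exists_omega_eq_tau hloc hsub
  have hKD : K ⊆ S.diamond u v := fun z hz => (hKsub hz).1
  have hKN : K ⊆ closure N := fun z hz => subset_closure (hKsub hz).2
  have hnhds : ∀ p q, 𝓝[(i '' K) ×ˢ (i '' K)] (i p, i q) =
      Filter.map (Prod.map i i) (𝓝[K ×ˢ K] (p, q)) := by
    intro p q
    rw [Set.prod_image_image_eq]
    exact ((hi.isEmbedding.prodMap hi.isEmbedding).map_nhdsWithin_eq (K ×ˢ K) (p, q)).symm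
  refine ⟨i '' K, ⟨Set.image_subset_range _ _, hKc.image hi.isEmbedding.continuous, ?_, ?_, ?_, ?_,
    ?_⟩, ?_⟩
  · rintro _ ⟨p, hp, rfl⟩ _ ⟨q, hq, rfl⟩ hf
    rw [hnhds, Filter.frequently_map] at hf
    simp only [Prod.map_fst, Prod.map_snd, hi.causal_iff] at hf
    exact (hi.causal_iff _ _).2 <| hNc.causal_of_frequently (hKN hp) (hKN hq) <|
      hf.filter_mono (nhdsWithin_mono _ (Set.prod_mono hKN hKN))
  · rintro _ ⟨p, hp, rfl⟩ _ ⟨q, hq, rfl⟩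
    rw [hi.tau_eq]
    exact hfin p (hKD hp) q (hKD hq)
  · rintro ⟨_, _⟩ ⟨⟨p, hp, rfl⟩, ⟨q, hq, rfl⟩⟩
    rw [ContinuousWithinAt, hnhds, Filter.tendsto_map'_iff]
    have := (hcont.mono (Set.prod_mono hKD hKD)) (p, q) ⟨hp, hq⟩
    simpa [Function.comp_def, hi.tau_eq] using this.tendsto
  · obtain ⟨C, hC⟩ := hloc.exists_length_bound
    refine ⟨C, fun g s hg hmono => iSup_le fun ⟨n, t, ht, hts⟩ => ?_⟩
    -- A lift of `g` to `X`; its values off `s` are irrelevant and set to `x`.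
    have hg' : ∀ x : ℝ, ∃ z, x ∈ s → z ∈ K ∧ i z = g x := fun r => by
      by_cases hr : r ∈ s
      · obtain ⟨z, hz, hzr⟩ := hg hr
        exact ⟨z, fun _ => ⟨hz, hzr⟩⟩
      · exact ⟨x, fun h => absurd h hr⟩
    choose f hf' using hg'
    have hfK : ∀ j, f (t j) ∈ K := fun j => (hf' _ (hts j)).1
    have hf : ∀ j, i (f (t j)) = g (t j) := fun j => (hf' _ (hts j)).2
    -- The sampled points form a causal chain, which a causal curve interpolates; that curve stays
    -- in the diamond, so the length bound of `Ω` applies. Consecutive sample times may coincide,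
    -- which is covered by reflexivity.
    obtain ⟨a, b, γ, hγ, h0, hn, hle⟩ := hS.exists_causalCurve_chain (fun j => f (t j)) n
      fun j _ => by
        rw [← hi.causal_iff, hf, hf]
        rcases (ht j.le_succ).eq_or_lt with he | hlt
        · rw [← Nat.succ_eq_add_one, ← he, ← hf, hi.causal_iff]
          exact hS.causal_refl _
        · exact hmono _ (hts _) _ (hts _) hlt
    refine le_trans (le_trans ?_ hle) (hC a b γ hγ ?_)
    · refine Finset.sum_le_sum fun j _ => ?_
      rw [edist_comm, ← hf, ← hf]
      simpa using hi.lipschitzWith (f (t j)) (f (t (j + 1)))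
    · refine (hγ.mapsTo_diamond hS.toIsPreLengthSpace.isAlgebraic ?_ ?_).mono_right hsub
      · rw [h0]; exact hKD (hfK _)
      · rw [hn]; exact hKD (hfK _)
  · rintro _ ⟨p, hp, rfl⟩ _ ⟨q, hq, rfl⟩ hpq
    obtain ⟨a, b, γ, hγ, rfl, rfl, hle⟩ := hmax p (hKD hp) q (hKD hq) ((hi.causal_iff _ _).1 hpq)
    exact ⟨a, b, _, hi.map_causalCurve hγ, rfl, rfl, by rwa [hi.tauLength_comp, hi.tau_eq]⟩
  · have : i '' K ∈ 𝓝[Set.range i] (i x) := by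
      rw [← hi.isEmbedding.map_nhds_eq]; exact Filter.image_mem_map hK
    exact mem_nhdsWithin_iff_eventually.1 this

end IsPieceEmbedding

end LorentzianStructure

/-! ### Chains and quotient structures -/

namespace QuotSpace

section Chains

variable {X : Type*} {s : Setoid X} {x y z : QuotSpace s} {n m : ℕ} {p q p' q' : ℕ → X}

/-- Induction along a chain, keeping track of the sum of the values of its steps. -/
theorem IsChain.induct (h : IsChain x y n p q) (val : X → X → ℝ≥0∞) (P : X → ℝ≥0∞ → Prop)
    (start : ∀ z, QuotSpace.mk s z = x → P z 0)
    (jump : ∀ z w c, QuotSpace.mk s z = QuotSpace.mk s w → P z c → P w c)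
    (move : ∀ i ≤ n, ∀ c, P (p i) c → P (q i) (c + val (p i) (q i)))
    {w : X} (hw : QuotSpace.mk s w = y) :
    P w (∑ i ∈ Finset.range (n + 1), val (p i) (q i)) := by
  have key : ∀ k ≤ n, P (q k) (∑ i ∈ Finset.range (k + 1), val (p i) (q i)) := by
    intro k
    induction k with
    | zero => intro hk; simpa using move 0 hk 0 (start _ h.start)
    | succ k ih =>
      intro hk
      rw [Finset.sum_range_succ]
      exact move _ hk _ (jump _ _ _ (h.jump k (by omega)) (ih (by omega)))
  exact jump _ _ _ (h.finish.trans hw.symm) (key n le_rfl)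

/-- A chain of index `n` has `n + 1` steps, so the combined `n + 1 + m + 1` steps have index `n + 1
+ m`. -/
theorem IsChain.append (h : IsChain x y n p q) (h' : IsChain y z m p' q') :
    ∃ P Q : ℕ → X, IsChain x z (n + 1 + m) P Q ∧
      (∀ R : X → X → Prop, (∀ i ≤ n, R (p i) (q i)) → (∀ i ≤ m, R (p' i) (q' i)) →
        ∀ i ≤ n + 1 + m, R (P i) (Q i)) ∧
      ∀ val : X → X → ℝ≥0∞, ∑ i ∈ Finset.range (n + 1 + m + 1), val (P i) (Q i) =
        ∑ i ∈ Finset.range (n + 1), val (p i) (q i) +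
          ∑ i ∈ Finset.range (m + 1), val (p' i) (q' i) := by
  refine ⟨fun i => if i < n + 1 then p i else p' (i - (n + 1)),
    fun i => if i < n + 1 then q i else q' (i - (n + 1)), ⟨?_, ?_, ?_⟩, ?_, ?_⟩
  · simpa using h.start
  · intro i hi
    rcases lt_trichotomy i n with hin | rfl | hin
    · rw [if_pos (by omega), if_pos (by omega)]
      exact h.jump i hin
    · rw [if_pos (by omega), if_neg (by omega), Nat.sub_self]
      exact h.finish.trans h'.start.symm
    · rw [if_neg (by omega), if_neg (by omega), show i + 1 - (n + 1) = i - (n + 1) + 1 by omega]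
      exact h'.jump _ (by omega)
  · rw [if_neg (by omega), Nat.add_sub_cancel_left]
    exact h'.finish
  · intro R h₁ h₂ i hi
    dsimp only
    split_ifs with hin
    · exact h₁ i (by omega)
    · exact h₂ _ (by omega)
  · intro val
    rw [add_assoc (n + 1) m 1, Finset.sum_range_add]
    refine congrArg₂ (· + ·) (Finset.sum_congr rfl fun i hi => ?_)
      (Finset.sum_congr rfl fun i _ => ?_)
    · dsimp only
      rw [if_pos (Finset.mem_range.1 hi), if_pos (Finset.mem_range.1 hi)]
    · dsimp only
      rw [if_neg (by omega), if_neg (by omega), Nat.add_sub_cancel_left]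

theorem isChain_single (a b : X) :
    IsChain (QuotSpace.mk s a) (QuotSpace.mk s b) 0 (fun _ => a) fun _ => b :=
  ⟨rfl, by simp, rfl⟩

end Chains

theorem edist_mk_le {X : Type*} [PseudoEMetricSpace X] {s : Setoid X} (a b : X) :
    edist (QuotSpace.mk s a) (QuotSpace.mk s b) ≤ edist a b :=
  (dist_le (isChain_single (s := s) a b)).trans (by simp)

end QuotSpace

namespace LorentzianStructure

open QuotSpace

section Quotient

variable {X : Type*} {S : LorentzianStructure X} {s : Setoid X}

theorem sum_le_quotTau {x y : QuotSpace s} {n : ℕ} {p q : ℕ → X} (h : IsChain x y n p q)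
    (hc : ∀ i ≤ n, S.causal (p i) (q i)) :
    ∑ i ∈ Finset.range (n + 1), S.tau (p i) (q i) ≤ S.quotTau s x y :=
  le_iSup_of_le n <| le_iSup_of_le p <| le_iSup_of_le q <| le_iSup_of_le ⟨h, hc⟩ le_rfl

theorem quotient_causal_mk {a b : X} (h : S.causal a b) :
    (S.quotient s).causal (QuotSpace.mk s a) (QuotSpace.mk s b) :=
  ⟨0, _, _, isChain_single a b, fun _ _ => h⟩

theorem le_quotient_tau_mk {a b : X} (h : S.causal a b) :
    S.tau a b ≤ (S.quotient s).tau (QuotSpace.mk s a) (QuotSpace.mk s b) :=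
  le_trans (by simp) (sum_le_quotTau (isChain_single (s := s) a b) fun _ _ => h)

theorem quotient_isAlgebraic (hrefl : ∀ x, S.causal x x) : (S.quotient s).IsAlgebraic := by
  have hca : ∀ x y, (S.quotient s).chron x y → (S.quotient s).causal x y := by
    intro x y hxy
    replace hxy : 0 < S.quotTau s x y := hxy
    rw [quotTau] at hxy
    simp only [lt_iSup_iff] at hxy
    obtain ⟨n, p, q, h, -⟩ := hxy
    exact ⟨n, p, q, h⟩
  have hta : ∀ x y z, (S.quotient s).causal x y → (S.quotient s).causal y z →
      (S.quotient s).tau x y + (S.quotient s).tau y z ≤ (S.quotient s).tau x z := by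
    rintro x y z ⟨n₀, p₀, q₀, h₀⟩ ⟨m₀, p₁, q₁, h₁⟩
    have key : ∀ n p q, IsChain x y n p q ∧ (∀ i ≤ n, S.causal (p i) (q i)) →
        ∀ m p' q', IsChain y z m p' q' ∧ (∀ i ≤ m, S.causal (p' i) (q' i)) →
        ∑ i ∈ Finset.range (n + 1), S.tau (p i) (q i) +
          ∑ i ∈ Finset.range (m + 1), S.tau (p' i) (q' i) ≤ S.quotTau s x z := by
      rintro n p q ⟨h, hc⟩ m p' q' ⟨h', hc'⟩
      obtain ⟨P, Q, hPQ, hR, hval⟩ := h.append h'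
      rw [← hval]
      exact sum_le_quotTau hPQ (hR _ hc hc')
    change S.quotTau s x y + S.quotTau s y z ≤ S.quotTau s x z
    -- Collecting the data of a chain into one index allows two suprema to be added; causality of
    -- both pairs provides the nonempty index families that this requires.
    have hsup : ∀ x y, S.quotTau s x y = ⨆ (r : ℕ × (ℕ → X) × (ℕ → X))
        (_ : IsChain x y r.1 r.2.1 r.2.2 ∧ ∀ i ≤ r.1, S.causal (r.2.1 i) (r.2.2 i)),
        ∑ i ∈ Finset.range (r.1 + 1), S.tau (r.2.1 i) (r.2.2 i) := fun x y => by
      simp only [quotTau, iSup_prod]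
    rw [hsup x y, hsup y z]
    exact ENNReal.biSup_add_biSup_le' ⟨(n₀, p₀, q₀), h₀⟩ ⟨(m₀, p₁, q₁), h₁⟩
      fun r hr r' hr' => key _ _ _ hr _ _ _ hr'
  refine ⟨fun x => ?_, ?_, ?_, hca, hta, fun _ _ => Iff.rfl⟩
  · obtain ⟨x, rfl⟩ : ∃ x', QuotSpace.mk s x' = x := Quotient.exists_rep x
    exact quotient_causal_mk (hrefl x)
  · rintro x y z ⟨n, p, q, h, hc⟩ ⟨m, p', q', h', hc'⟩
    obtain ⟨P, Q, hPQ, hR, -⟩ := h.append h'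
    exact ⟨_, P, Q, hPQ, hR _ hc hc'⟩
  · intro x y z hxy hyz
    exact lt_of_lt_of_le (lt_of_lt_of_le hxy le_self_add) (hta x y z (hca _ _ hxy) (hca _ _ hyz))

end Quotient

end LorentzianStructure

/-! ### Points, metric and topology of the amalgamation -/

namespace Amalgamation

open QuotSpace

section Points

variable {X₁ X₂ : Type*} {A₁ : Set X₁} {A₂ : Set X₂}

/-- The map of the first space to the amalgamation. -/
def inl (f : A₁ → A₂) (x : X₁) : Amalgamation f := QuotSpace.mk (gluingSetoid f) (Sum.inl x)

/-- The map of the second space to the amalgamation. -/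
def inr (f : A₁ → A₂) (x : X₂) : Amalgamation f := QuotSpace.mk (gluingSetoid f) (Sum.inr x)

theorem exists_rep (f : A₁ → A₂) (y : Amalgamation f) :
    (∃ x, inl f x = y) ∨ ∃ x, inr f x = y := by
  obtain ⟨z, rfl⟩ : ∃ z, QuotSpace.mk (gluingSetoid f) z = y := Quotient.exists_rep y
  rcases z with x | x
  exacts [Or.inl ⟨x, rfl⟩, Or.inr ⟨x, rfl⟩]

/-- As `f` is injective, composing a gluing with a reverse gluing gives the identity, so generating
the equivalence relation adds only reflexivity and symmetry. -/
theorem mk_eq_mk {f : A₁ → A₂} (hf : Function.Injective f) {z w : DisjUnion X₁ X₂}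
    (h : QuotSpace.mk (gluingSetoid f) z = QuotSpace.mk (gluingSetoid f) w) :
    z = w ∨ (∃ a : A₁, z = Sum.inl (a : X₁) ∧ w = Sum.inr (f a : X₂)) ∨
      ∃ a : A₁, w = Sum.inl (a : X₁) ∧ z = Sum.inr (f a : X₂) := by
  have h' : Relation.EqvGen (fun x y : DisjUnion X₁ X₂ =>
      ∃ a : A₁, x = Sum.inl (a : X₁) ∧ y = Sum.inr (f a : X₂)) z w := Quotient.exact h
  clear h
  induction h' with
  | rel x y h => exact Or.inr (Or.inl h)
  | refl x => exact Or.inl rfl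
  | symm x y _ ih =>
    rcases ih with rfl | h | h
    exacts [Or.inl rfl, Or.inr (Or.inr h), Or.inr (Or.inl h)]
  | trans x y z _ _ ih₁ ih₂ =>
    rcases ih₁ with rfl | ⟨a, rfl, rfl⟩ | ⟨a, rfl, rfl⟩
    · exact ih₂
    · rcases ih₂ with rfl | ⟨b, hb, -⟩ | ⟨b, rfl, hb⟩
      · exact Or.inr (Or.inl ⟨a, rfl, rfl⟩)
      · cases hb
      · rw [hf (Subtype.ext (Sum.inr_injective hb))]
        exact Or.inl rfl
    · rcases ih₂ with rfl | ⟨b, hb, rfl⟩ | ⟨b, rfl, hb⟩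
      · exact Or.inr (Or.inr ⟨a, rfl, rfl⟩)
      · rw [Subtype.ext (Sum.inl_injective hb)]
        exact Or.inl rfl
      · cases hb

theorem inl_eq_inr (f : A₁ → A₂) (a : A₁) : inl f (a : X₁) = inr f (f a : X₂) :=
  Quotient.sound (Relation.EqvGen.rel _ _ ⟨a, rfl, rfl⟩)

theorem inl_injective {f : A₁ → A₂} (hf : Function.Injective f) :
    Function.Injective (inl f : X₁ → Amalgamation f) := by
  intro x y h
  rcases mk_eq_mk hf h with h | ⟨a, -, h⟩ | ⟨a, -, h⟩
  · exact Sum.inl_injective h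
  · cases h
  · cases h

theorem inr_injective {f : A₁ → A₂} (hf : Function.Injective f) :
    Function.Injective (inr f : X₂ → Amalgamation f) := by
  intro x y h
  rcases mk_eq_mk hf h with h | ⟨a, h, -⟩ | ⟨a, h, -⟩
  · exact Sum.inr_injective h
  · cases h
  · cases h

theorem exists_of_inl_eq_inr {f : A₁ → A₂} (hf : Function.Injective f) {x : X₁} {y : X₂}
    (h : inl f x = inr f y) : ∃ a : A₁, (a : X₁) = x ∧ (f a : X₂) = y := by
  rcases mk_eq_mk hf h with h | ⟨a, h₁, h₂⟩ | ⟨a, h, -⟩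
  · cases h
  · exact ⟨a, (Sum.inl_injective h₁).symm, (Sum.inr_injective h₂).symm⟩
  · cases h

end Points

variable {X₁ X₂ : Type*} {A₁ : Set X₁} {A₂ : Set X₂} [PseudoEMetricSpace X₁]
  [PseudoEMetricSpace X₂]

theorem lipschitzWith_inl (f : A₁ → A₂) : LipschitzWith 1 (inl f : X₁ → Amalgamation f) :=
  fun x y => by
    rw [ENNReal.coe_one, one_mul]
    exact edist_mk_le (X := DisjUnion X₁ X₂) _ _

theorem lipschitzWith_inr (f : A₁ → A₂) : LipschitzWith 1 (inr f : X₂ → Amalgamation f) :=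
  fun x y => by
    rw [ENNReal.coe_one, one_mul]
    exact edist_mk_le (X := DisjUnion X₁ X₂) _ _

theorem exists_chain_of_edist_lt {X : Type*} [PseudoEMetricSpace X] {s : Setoid X}
    {x y : QuotSpace s} {ε : ℝ≥0∞} (h : edist x y < ε) : ∃ n p q, IsChain x y n p q ∧
      ∑ i ∈ Finset.range (n + 1), edist (p i) (q i) < ε := by
  replace h : QuotSpace.dist x y < ε := h
  rw [QuotSpace.dist] at h
  simp only [iInf_lt_iff] at h
  obtain ⟨n, p, q, hc, hlt⟩ := h
  exact ⟨n, p, q, hc, hlt⟩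

/-- Near a point at which the equivalence relation is locally trivial, the quotient metric is
bounded below by the metric. -/
theorem edist_lt_of_edist_mk_lt {X : Type*} [PseudoEMetricSpace X] {s : Setoid X} {z₀ w : X}
    {ε : ℝ≥0∞} (htriv : ∀ z, edist z₀ z < ε → ∀ w, QuotSpace.mk s z = QuotSpace.mk s w → z = w)
    (h : edist (QuotSpace.mk s z₀) (QuotSpace.mk s w) < ε) : edist z₀ w < ε := by
  obtain ⟨n, p, q, hc, hlt⟩ := exists_chain_of_edist_lt h
  have hε : 0 < ε := pos_of_gt h
  -- While the accumulated length stays below `ε`, the current point is in the region of trivial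
  -- jumps, so the whole chain is a path in `X` and the triangle inequality applies.
  refine (hc.induct edist (fun z c => c < ε → edist z₀ z ≤ c) ?_ ?_ ?_ rfl hlt).trans_lt hlt
  · intro z hz _
    rw [htriv z₀ (by simpa using hε) z hz.symm, edist_self]
  · intro z w c hzw hP hc
    rw [← htriv z ((hP hc).trans_lt hc) w hzw]
    exact hP hc
  · intro i _ c hP hc
    exact (edist_triangle _ (p i) _).trans
      (add_le_add_left (hP (le_self_add.trans_lt hc)) _)

/-- The distance to a point of the gluing set, measured in the space of the other point. -/
noncomputable def gluingDist (f : A₁ → A₂) (b : A₁) (z : DisjUnion X₁ X₂) : ℝ≥0∞ :=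
  Sum.elim (fun x => edist (b : X₁) x) (fun x => edist (f b : X₂) x) z

theorem gluingDist_le (f : A₁ → A₂) (b : A₁) (z w : DisjUnion X₁ X₂) :
    gluingDist f b w ≤ gluingDist f b z + edist z w := by
  rcases z with z | z <;> rcases w with w | w
  · exact edist_triangle _ _ _
  · exact le_of_le_of_eq le_top (add_top _).symm
  · exact le_of_le_of_eq le_top (add_top _).symm
  · exact edist_triangle _ _ _

/-- Near a point of the gluing set, the quotient metric is bounded below by a multiple of the
metrics of the two spaces. -/
theorem exists_gluingDist_le {f : A₁ ≃ₜ A₂} (hf : LocallyBiLipschitz f) (a : A₁) :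
    ∃ L : ℝ≥0, 0 < L ∧ ∃ r > 0, ∀ w, ∀ ε ≤ r,
      edist (inl f (a : X₁)) (QuotSpace.mk (gluingSetoid f) w) < ε →
      ∃ c < ε, gluingDist f a w ≤ L * c := by
  obtain ⟨U, hU, K, hK, hK'⟩ := hf a
  obtain ⟨r₁, hr₁, hU₁⟩ := EMetric.mem_nhds_iff.1 hU
  have hU' : f.symm ⁻¹' U ∈ 𝓝 (f a) := f.symm.continuous.continuousAt (by simpa using hU)
  obtain ⟨r₂, hr₂, hU₂⟩ := EMetric.mem_nhds_iff.1 hU'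
  replace hU₁ : ∀ b : A₁, edist (a : X₁) b < r₁ → b ∈ U := fun b hb =>
    hU₁ (by rw [Metric.mem_eball, edist_comm]; exact hb)
  replace hU₂ : ∀ b : A₁, edist (f a : X₂) (f b) < r₂ → b ∈ U := fun b hb => by
    simpa using hU₂ (show f b ∈ _ by rw [Metric.mem_eball, edist_comm]; exact hb)
  replace hK : ∀ b ∈ U, ∀ b' ∈ U, edist (f b : X₂) (f b') ≤ K * edist (b : X₁) b' :=
    fun b hb b' hb' => hK hb hb'
  replace hK' : ∀ b ∈ U, ∀ b' ∈ U, edist (b : X₁) b' ≤ K * edist (f b : X₂) (f b') := by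
    intro b hb b' hb'
    have := hK' (Set.mem_image_of_mem f hb) (Set.mem_image_of_mem f hb')
    rwa [f.symm_apply_apply, f.symm_apply_apply] at this
  set L : ℝ≥0 := max K 1 with hL_def
  have hL : 0 < L := lt_max_of_lt_right one_pos
  have hKL : (K : ℝ≥0∞) ≤ L := ENNReal.coe_le_coe.2 (le_max_left _ _)
  have h1L : (1 : ℝ≥0∞) ≤ L := by
    rw [← ENNReal.coe_one]; exact ENNReal.coe_le_coe.2 (le_max_right _ _)
  -- This radius keeps every glued point that a short chain visits inside `U`, where the Lipschitz
  -- bounds hold.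
  refine ⟨L, hL, min r₁ r₂ / L, ENNReal.div_pos (lt_min hr₁ hr₂).ne' ENNReal.coe_ne_top, ?_⟩
  intro w ε hε hlt
  have hmul : ∀ c < ε, L * c < r₁ ∧ L * c < r₂ := by
    intro c hc
    rw [← lt_min_iff, mul_comm]
    exact (ENNReal.lt_div_iff_mul_lt (Or.inl (by simpa using hL.ne')) (Or.inl ENNReal.coe_ne_top)).1
      (hc.trans_le hε)
  obtain ⟨n, p, q, hc, hsum⟩ := exists_chain_of_edist_lt hlt
  have one_le : ∀ t : ℝ≥0∞, t ≤ L * t := fun t => by simpa using mul_le_mul_left h1L t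
  have key : ∀ b : A₁, ∀ c c' : ℝ≥0∞, c < ε → b ∈ U → edist (a : X₁) b ≤ L * c' →
      edist (f a : X₂) (f b) ≤ L * c' → ∀ b' : A₁,
      (c' + edist (b : X₁) b' ≤ c ∨ c' + edist (f b : X₂) (f b') ≤ c) →
      b' ∈ U ∧ edist (a : X₁) b' ≤ L * c ∧ edist (f a : X₂) (f b') ≤ L * c := by
    rintro b c c' hc hb h₁ h₂ b' (hb' | hb')
    · have e₁ : edist (a : X₁) b' ≤ L * c := by
        calc edist (a : X₁) b' ≤ edist (a : X₁) b + edist (b : X₁) b' := edist_triangle _ _ _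
          _ ≤ L * c' + L * edist (b : X₁) b' := add_le_add h₁ (one_le _)
          _ ≤ L * c := by rw [← mul_add]; gcongr
      have hb'U := hU₁ b' (e₁.trans_lt (hmul c hc).1)
      refine ⟨hb'U, e₁, ?_⟩
      calc edist (f a : X₂) (f b') ≤ edist (f a : X₂) (f b) + edist (f b : X₂) (f b') :=
            edist_triangle _ _ _
        _ ≤ L * c' + L * edist (b : X₁) b' :=
            add_le_add h₂ ((hK b hb b' hb'U).trans (by gcongr))
        _ ≤ L * c := by rw [← mul_add]; gcongr
    · have e₁ : edist (f a : X₂) (f b') ≤ L * c := by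
        calc edist (f a : X₂) (f b') ≤ edist (f a : X₂) (f b) + edist (f b : X₂) (f b') :=
              edist_triangle _ _ _
          _ ≤ L * c' + L * edist (f b : X₂) (f b') := add_le_add h₂ (one_le _)
          _ ≤ L * c := by rw [← mul_add]; gcongr
      have hb'U := hU₂ b' (e₁.trans_lt (hmul c hc).2)
      refine ⟨hb'U, ?_, e₁⟩
      calc edist (a : X₁) b' ≤ edist (a : X₁) b + edist (b : X₁) b' := edist_triangle _ _ _
        _ ≤ L * c' + L * edist (f b : X₂) (f b') :=
            add_le_add h₁ ((hK' b hb b' hb'U).trans (by gcongr))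
        _ ≤ L * c := by rw [← mul_add]; gcongr
  -- The invariant remembers the last gluing point `b`, reached after length `c'` and within `L *
  -- c'` of `a` in both spaces. Each segment between gluing points is converted between the metrics
  -- only once, so the constant does not compound with the number of jumps.
  obtain ⟨b, c', hb, h₁, h₂, h₃⟩ := hc.induct edist
    (fun z c => c < ε → ∃ b : A₁, ∃ c' : ℝ≥0∞, b ∈ U ∧ edist (a : X₁) b ≤ L * c' ∧
      edist (f a : X₂) (f b) ≤ L * c' ∧ c' + gluingDist f b z ≤ c)
    (by
      intro z hz _
      refine ⟨a, 0, mem_of_mem_nhds hU, by simp, by simp, ?_⟩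
      rcases mk_eq_mk f.injective hz with rfl | ⟨b, rfl, hb⟩ | ⟨b, hb, rfl⟩
      · simp [gluingDist]
      · cases hb
      · rw [Subtype.ext (Sum.inl_injective hb)]
        simp [gluingDist])
    (by
      intro z w c hzw hP hcε
      obtain ⟨b, c', hb, h₁, h₂, h₃⟩ := hP hcε
      rcases mk_eq_mk f.injective hzw with rfl | ⟨b', rfl, rfl⟩ | ⟨b', rfl, rfl⟩
      · exact ⟨b, c', hb, h₁, h₂, h₃⟩
      · obtain ⟨e₀, e₁, e₂⟩ := key b c c' hcε hb h₁ h₂ b' (Or.inl h₃)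
        exact ⟨b', c, e₀, e₁, e₂, by simp [gluingDist]⟩
      · obtain ⟨e₀, e₁, e₂⟩ := key b c c' hcε hb h₁ h₂ b' (Or.inr h₃)
        exact ⟨b', c, e₀, e₁, e₂, by simp [gluingDist]⟩)
    (by
      intro i _ c hP hcε
      obtain ⟨b, c', hb, h₁, h₂, h₃⟩ := hP (le_self_add.trans_lt hcε)
      refine ⟨b, c', hb, h₁, h₂, ?_⟩
      calc c' + gluingDist f b (q i) ≤ c' + (gluingDist f b (p i) + edist (p i) (q i)) := by
            gcongr; exact gluingDist_le _ _ _ _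
        _ ≤ _ := by rw [← add_assoc]; gcongr)
    (w := w) rfl hsum
  refine ⟨_, hsum, ?_⟩
  rcases w with x | x
  · calc edist (a : X₁) x ≤ edist (a : X₁) b + edist (b : X₁) x := edist_triangle _ _ _
      _ ≤ L * c' + L * edist (b : X₁) x := add_le_add h₁ (one_le _)
      _ ≤ _ := by rw [← mul_add]; gcongr; exact h₃
  · calc edist (f a : X₂) x ≤ edist (f a : X₂) (f b) + edist (f b : X₂) x := edist_triangle _ _ _
      _ ≤ L * c' + L * edist (f b : X₂) x := add_le_add h₂ (one_le _)
      _ ≤ _ := by rw [← mul_add]; gcongr; exact h₃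

variable {f : A₁ ≃ₜ A₂}

theorem mem_nhds_of_edist_lt {y : Amalgamation f} {V : Set (Amalgamation f)} {ε : ℝ≥0∞}
    (hε : 0 < ε) (h : ∀ w, edist y (QuotSpace.mk (gluingSetoid f) w) < ε →
      QuotSpace.mk (gluingSetoid f) w ∈ V) : V ∈ 𝓝 y := by
  refine EMetric.mem_nhds_iff.2 ⟨ε, hε, fun y' hy' => ?_⟩
  obtain ⟨w, rfl⟩ : ∃ w, QuotSpace.mk (gluingSetoid f) w = y' := Quotient.exists_rep y'
  exact h w (by rw [edist_comm]; exact hy')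

/-- The metric topology is the quotient topology, so neighbourhoods can be tested in each space. At
glued points small balls are controlled in both spaces by `exists_gluingDist_le`; elsewhere
closedness of `A₁` and `A₂` keeps small balls away from the gluing. -/
theorem mem_nhds_of_preimage_mem_nhds {y : Amalgamation f} {V : Set (Amalgamation f)}
    (hA₁ : IsClosed A₁) (hA₂ : IsClosed A₂) (hf : LocallyBiLipschitz f)
    (h₁ : ∀ x, inl f x = y → inl f ⁻¹' V ∈ 𝓝 x) (h₂ : ∀ x, inr f x = y → inr f ⁻¹' V ∈ 𝓝 x) :
    V ∈ 𝓝 y := by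
  by_cases hy : ∃ a : A₁, inl f (a : X₁) = y
  · obtain ⟨a, rfl⟩ := hy
    obtain ⟨L, hL, r, hr, hdist⟩ := exists_gluingDist_le hf a
    obtain ⟨δ₁, hδ₁, hV₁⟩ := EMetric.mem_nhds_iff.1 (h₁ a rfl)
    obtain ⟨δ₂, hδ₂, hV₂⟩ := EMetric.mem_nhds_iff.1 (h₂ (f a) (inl_eq_inr f a).symm)
    refine mem_nhds_of_edist_lt (ε := min r (min δ₁ δ₂ / L)) (lt_min hr
      (ENNReal.div_pos (lt_min hδ₁ hδ₂).ne' ENNReal.coe_ne_top)) fun w hw => ?_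
    obtain ⟨c, hc, hle⟩ := hdist w _ (min_le_left _ _) hw
    have hlt : gluingDist f a w < min δ₁ δ₂ := by
      refine hle.trans_lt ?_
      rw [mul_comm]
      exact (ENNReal.lt_div_iff_mul_lt (Or.inl (by simpa using hL.ne'))
        (Or.inl ENNReal.coe_ne_top)).1 (hc.trans_le (min_le_right _ _))
    rcases w with x | x
    · refine hV₁ ?_
      rw [Metric.mem_eball, edist_comm]
      exact hlt.trans_le (min_le_left _ _)
    · refine hV₂ ?_
      rw [Metric.mem_eball, edist_comm]
      exact hlt.trans_le (min_le_right _ _)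
  · rcases exists_rep f y with ⟨x, rfl⟩ | ⟨x, rfl⟩
    · have hx : x ∉ A₁ := fun hx => hy ⟨⟨x, hx⟩, rfl⟩
      obtain ⟨r, hr, hball⟩ := EMetric.mem_nhds_iff.1
        (Filter.inter_mem (hA₁.isOpen_compl.mem_nhds hx) (h₁ x rfl))
      refine mem_nhds_of_edist_lt hr fun w hw => ?_
      have hlt := edist_lt_of_edist_mk_lt (X := DisjUnion X₁ X₂) (z₀ := Sum.inl x) ?_ hw
      · rcases w with x' | x'
        · exact (hball (by rw [Metric.mem_eball, edist_comm]; exact hlt)).2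
        · exact absurd hlt not_top_lt
      · intro z hz w hzw
        rcases mk_eq_mk f.injective hzw with rfl | ⟨a, rfl, rfl⟩ | ⟨a, rfl, rfl⟩
        · rfl
        · exact absurd a.2 (hball (by rw [Metric.mem_eball, edist_comm]; exact hz)).1
        · exact absurd hz not_top_lt
    · have hx : x ∉ A₂ := fun hx => hy ⟨f.symm ⟨x, hx⟩, by rw [inl_eq_inr]; simp⟩
      obtain ⟨r, hr, hball⟩ := EMetric.mem_nhds_iff.1
        (Filter.inter_mem (hA₂.isOpen_compl.mem_nhds hx) (h₂ x rfl))
      refine mem_nhds_of_edist_lt hr fun w hw => ?_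
      have hlt := edist_lt_of_edist_mk_lt (X := DisjUnion X₁ X₂) (z₀ := Sum.inr x) ?_ hw
      · rcases w with x' | x'
        · exact absurd hlt not_top_lt
        · exact (hball (by rw [Metric.mem_eball, edist_comm]; exact hlt)).2
      · intro z hz w hzw
        rcases mk_eq_mk f.injective hzw with rfl | ⟨a, rfl, rfl⟩ | ⟨a, rfl, rfl⟩
        · rfl
        · exact absurd hz not_top_lt
        · exact absurd (f a).2 (hball (by rw [Metric.mem_eball, edist_comm]; exact hz)).1

variable (hA₁ : IsClosed A₁) (hA₂ : IsClosed A₂) (hf : LocallyBiLipschitz f)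
include hA₁ hA₂ hf

theorem isClosed_range_inl : IsClosed (Set.range (inl f : X₁ → Amalgamation f)) := by
  rw [← isOpen_compl_iff, isOpen_iff_mem_nhds]
  intro y hy
  refine mem_nhds_of_preimage_mem_nhds hA₁ hA₂ hf (fun x hx => absurd ⟨x, hx⟩ hy) fun x hx => ?_
  have hxA : x ∉ A₂ := fun h => hy ⟨f.symm ⟨x, h⟩, by rw [inl_eq_inr]; simpa using hx⟩
  filter_upwards [hA₂.isOpen_compl.mem_nhds hxA] with z hz
  rintro ⟨x', hx'⟩
  obtain ⟨a, -, rfl⟩ := exists_of_inl_eq_inr f.injective hx'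
  exact hz (f a).2

theorem isClosed_range_inr : IsClosed (Set.range (inr f : X₂ → Amalgamation f)) := by
  rw [← isOpen_compl_iff, isOpen_iff_mem_nhds]
  intro y hy
  refine mem_nhds_of_preimage_mem_nhds hA₁ hA₂ hf (fun x hx => ?_) fun x hx => absurd ⟨x, hx⟩ hy
  have hxA : x ∉ A₁ := fun h => hy ⟨f ⟨x, h⟩, by rw [← inl_eq_inr]; exact hx⟩
  filter_upwards [hA₁.isOpen_compl.mem_nhds hxA] with z hz
  rintro ⟨x', hx'⟩
  obtain ⟨a, rfl, -⟩ := exists_of_inl_eq_inr f.injective hx'.symm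
  exact hz a.2

theorem isEmbedding_inl : Topology.IsEmbedding (inl f : X₁ → Amalgamation f) := by
  refine ⟨Topology.isInducing_iff_nhds.2 fun x => le_antisymm
    (Filter.map_le_iff_le_comap.1 (lipschitzWith_inl f).continuous.continuousAt) fun U hU => ?_,
    inl_injective f.injective⟩
  -- The set of points with no `inl`-preimage outside `U`; in the second space it is a neighbourhood
  -- of a glued point because `f.symm` is continuous.
  refine Filter.mem_comap.2 ⟨{y | ∀ x', inl f x' = y → x' ∈ U}, ?_, fun x' hx' => hx' x' rfl⟩
  refine mem_nhds_of_preimage_mem_nhds hA₁ hA₂ hf (fun x' hx' => ?_) fun x' hx' => ?_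
  · obtain rfl := inl_injective f.injective hx'
    filter_upwards [hU] with z hz w hw
    rwa [inl_injective f.injective hw]
  · obtain ⟨a, rfl, rfl⟩ := exists_of_inl_eq_inr f.injective hx'.symm
    have hV : {b : A₂ | (f.symm b : X₁) ∈ U} ∈ 𝓝 (f a) := by
      have hc : Continuous fun b : A₂ => (f.symm b : X₁) := by fun_prop
      exact hc.continuousAt (by simpa using hU)
    obtain ⟨O, hO, hOV⟩ := mem_nhds_subtype _ _ _ |>.1 hV
    filter_upwards [hO] with z hz w hw
    obtain ⟨b, rfl, rfl⟩ := exists_of_inl_eq_inr f.injective hw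
    simpa using hOV (show f b ∈ _ from hz)

theorem isEmbedding_inr : Topology.IsEmbedding (inr f : X₂ → Amalgamation f) := by
  refine ⟨Topology.isInducing_iff_nhds.2 fun x => le_antisymm
    (Filter.map_le_iff_le_comap.1 (lipschitzWith_inr f).continuous.continuousAt) fun U hU => ?_,
    inr_injective f.injective⟩
  refine Filter.mem_comap.2 ⟨{y | ∀ x', inr f x' = y → x' ∈ U}, ?_, fun x' hx' => hx' x' rfl⟩
  refine mem_nhds_of_preimage_mem_nhds hA₁ hA₂ hf (fun x' hx' => ?_) fun x' hx' => ?_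
  · obtain ⟨a, rfl, rfl⟩ := exists_of_inl_eq_inr f.injective hx'
    have hV : {b : A₁ | (f b : X₂) ∈ U} ∈ 𝓝 a := by
      have hc : Continuous fun b : A₁ => (f b : X₂) := by fun_prop
      exact hc.continuousAt hU
    obtain ⟨O, hO, hOV⟩ := mem_nhds_subtype _ _ _ |>.1 hV
    filter_upwards [hO] with z hz w hw
    obtain ⟨b, rfl, rfl⟩ := exists_of_inl_eq_inr f.injective hw.symm
    exact hOV (show b ∈ _ from hz)
  · obtain rfl := inr_injective f.injective hx'
    filter_upwards [hU] with z hz w hw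
    rwa [inr_injective f.injective hw]

/-- Points at distance zero are inseparable, so they lie in the same closed pieces, and the
embedding of such a piece reflects inseparability. -/
theorem eq_of_edist_eq_zero (h₁ : ∀ x y : X₁, edist x y = 0 → x = y)
    (h₂ : ∀ x y : X₂, edist x y = 0 → x = y) (x y : Amalgamation f) (h : edist x y = 0) :
    x = y := by
  have hins := EMetric.inseparable_iff.2 h
  rcases exists_rep f x with ⟨x, rfl⟩ | ⟨x, rfl⟩
  · obtain ⟨y, rfl⟩ := (hins.mem_closed_iff (isClosed_range_inl hA₁ hA₂ hf)).1 ⟨x, rfl⟩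
    rw [(isEmbedding_inl hA₁ hA₂ hf).isInducing.inseparable_iff, EMetric.inseparable_iff] at hins
    rw [h₁ x y hins]
  · obtain ⟨y, rfl⟩ := (hins.mem_closed_iff (isClosed_range_inr hA₁ hA₂ hf)).1 ⟨x, rfl⟩
    rw [(isEmbedding_inr hA₁ hA₂ hf).isInducing.inseparable_iff, EMetric.inseparable_iff] at hins
    rw [h₂ x y hins]

end Amalgamation

/-! ### Causal structure of the amalgamation -/

namespace Amalgamation

open LorentzianStructure QuotSpace

variable {X₁ X₂ : Type*} {A₁ : Set X₁} {A₂ : Set X₂} {S₁ : LorentzianStructure X₁}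
  {S₂ : LorentzianStructure X₂}

section Causal

variable {f : A₁ → A₂}

theorem exists_chain_of_lt_tau {x y : Amalgamation f} {c : ℝ≥0∞}
    (h : c < (S₁.amalgamation S₂ f).tau x y) : ∃ n p q, IsChain x y n p q ∧
      (∀ i ≤ n, (S₁.disjUnion S₂).causal (p i) (q i)) ∧
      c < ∑ i ∈ Finset.range (n + 1), (S₁.disjUnion S₂).tau (p i) (q i) := by
  replace h : c < (S₁.disjUnion S₂).quotTau (gluingSetoid f) x y := h
  rw [quotTau] at h
  simp only [lt_iSup_iff] at h
  obtain ⟨n, p, q, ⟨hc, hcausal⟩, hlt⟩ := h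
  exact ⟨n, p, q, hc, hcausal, hlt⟩

variable (h₁ : S₁.IsAlgebraic) (h₂ : S₂.IsAlgebraic) (hf : Function.Injective f)
  (hτ : ∀ a b : A₁, S₁.tau a b = S₂.tau (f a) (f b))
  (hc : ∀ a b : A₁, S₁.causal a b ↔ S₂.causal (f a) (f b))
include h₁ h₂ hf hτ hc

/-- A causal chain that starts in the first space can be reduced to one with at most one jump. -/
theorem chain_from_inl {x : X₁} {y : Amalgamation f} {n : ℕ} {p q : ℕ → DisjUnion X₁ X₂}
    (h : IsChain (inl f x) y n p q)
    (hcausal : ∀ i ≤ n, (S₁.disjUnion S₂).causal (p i) (q i)) {w : DisjUnion X₁ X₂}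
    (hw : QuotSpace.mk (gluingSetoid f) w = y) :
    Sum.elim
      (fun z => S₁.causal x z ∧
        ∑ i ∈ Finset.range (n + 1), (S₁.disjUnion S₂).tau (p i) (q i) ≤ S₁.tau x z)
      (fun z => ∃ a : A₁, S₁.causal x a ∧ S₂.causal (f a) z ∧
        ∑ i ∈ Finset.range (n + 1), (S₁.disjUnion S₂).tau (p i) (q i) ≤
          S₁.tau x a + S₂.tau (f a) z) w := by
  refine h.induct (S₁.disjUnion S₂).tau (fun w c => Sum.elim
      (fun z => S₁.causal x z ∧ c ≤ S₁.tau x z)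
      (fun z => ∃ a : A₁, S₁.causal x a ∧ S₂.causal (f a) z ∧ c ≤ S₁.tau x a + S₂.tau (f a) z) w)
    ?_ ?_ ?_ hw
  · intro z hz
    rcases mk_eq_mk hf hz with rfl | ⟨a, rfl, hb⟩ | ⟨a, ha, rfl⟩
    · exact ⟨h₁.causal_refl _, zero_le⟩
    · cases hb
    · exact ⟨a, Sum.inl_injective ha ▸ h₁.causal_refl _, h₂.causal_refl _, zero_le⟩
  · intro z w c hzw hP
    rcases mk_eq_mk hf hzw with rfl | ⟨a, rfl, rfl⟩ | ⟨a, rfl, rfl⟩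
    · exact hP
    · exact ⟨a, hP.1, h₂.causal_refl _, hP.2.trans le_self_add⟩
    -- The chain returns to the first space at `a`: the relation from `f b` to `f a` transfers to
    -- `A₁`, and the excursion is absorbed by the reverse triangle inequality.
    · obtain ⟨b, hxb, hba, hle⟩ := hP
      rw [← hc] at hba
      rw [← hτ] at hle
      exact ⟨h₁.causal_trans _ _ _ hxb hba, hle.trans (h₁.tau_add_le _ _ _ hxb hba)⟩
  · intro i hi c hP
    have hi := hcausal i hi
    revert hP hi
    generalize p i = u
    generalize q i = v
    rintro hP hi
    cases hi with
    | inl hi =>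
      exact ⟨h₁.causal_trans _ _ _ hP.1 hi,
        (add_le_add_left hP.2 _).trans (h₁.tau_add_le _ _ _ hP.1 hi)⟩
    | inr hi =>
      obtain ⟨a, hxa, haz, hle⟩ := hP
      refine ⟨a, hxa, h₂.causal_trans _ _ _ haz hi, (add_le_add_left hle _).trans ?_⟩
      rw [add_assoc]
      exact add_le_add_right (h₂.tau_add_le _ _ _ haz hi) _

/-- A causal chain that starts in the second space can be reduced to one with at most one jump. -/
theorem chain_from_inr {x : X₂} {y : Amalgamation f} {n : ℕ} {p q : ℕ → DisjUnion X₁ X₂}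
    (h : IsChain (inr f x) y n p q)
    (hcausal : ∀ i ≤ n, (S₁.disjUnion S₂).causal (p i) (q i)) {w : DisjUnion X₁ X₂}
    (hw : QuotSpace.mk (gluingSetoid f) w = y) :
    Sum.elim
      (fun z => ∃ a : A₁, S₂.causal x (f a) ∧ S₁.causal a z ∧
        ∑ i ∈ Finset.range (n + 1), (S₁.disjUnion S₂).tau (p i) (q i) ≤
          S₂.tau x (f a) + S₁.tau a z)
      (fun z => S₂.causal x z ∧
        ∑ i ∈ Finset.range (n + 1), (S₁.disjUnion S₂).tau (p i) (q i) ≤ S₂.tau x z) w := by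
  refine h.induct (S₁.disjUnion S₂).tau (fun w c => Sum.elim
      (fun z => ∃ a : A₁, S₂.causal x (f a) ∧ S₁.causal a z ∧ c ≤ S₂.tau x (f a) + S₁.tau a z)
      (fun z => S₂.causal x z ∧ c ≤ S₂.tau x z) w)
    ?_ ?_ ?_ hw
  · intro z hz
    rcases mk_eq_mk hf hz with rfl | ⟨a, rfl, hb⟩ | ⟨a, ha, -⟩
    · exact ⟨h₂.causal_refl _, zero_le⟩
    · exact ⟨a, Sum.inr_injective hb ▸ h₂.causal_refl _, h₁.causal_refl _, zero_le⟩
    · cases ha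
  · intro z w c hzw hP
    rcases mk_eq_mk hf hzw with rfl | ⟨a, rfl, rfl⟩ | ⟨a, rfl, rfl⟩
    · exact hP
    · obtain ⟨b, hxb, hba, hle⟩ := hP
      rw [hc] at hba
      rw [hτ] at hle
      exact ⟨h₂.causal_trans _ _ _ hxb hba, hle.trans (h₂.tau_add_le _ _ _ hxb hba)⟩
    · exact ⟨a, hP.1, h₁.causal_refl _, hP.2.trans le_self_add⟩
  · intro i hi c hP
    have hi := hcausal i hi
    revert hP hi
    generalize p i = u
    generalize q i = v
    rintro hP hi
    cases hi with
    | inr hi =>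
      exact ⟨h₂.causal_trans _ _ _ hP.1 hi,
        (add_le_add_left hP.2 _).trans (h₂.tau_add_le _ _ _ hP.1 hi)⟩
    | inl hi =>
      obtain ⟨a, hxa, haz, hle⟩ := hP
      refine ⟨a, hxa, h₁.causal_trans _ _ _ haz hi, (add_le_add_left hle _).trans ?_⟩
      rw [add_assoc]
      exact add_le_add_right (h₁.tau_add_le _ _ _ haz hi) _

theorem causal_inl_inl (x y : X₁) :
    (S₁.amalgamation S₂ f).causal (inl f x) (inl f y) ↔ S₁.causal x y := by
  refine ⟨?_, fun h => quotient_causal_mk (S := S₁.disjUnion S₂) (Sum.LiftRel.inl h)⟩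
  rintro ⟨n, p, q, h, hcausal⟩
  exact (chain_from_inl h₁ h₂ hf hτ hc h hcausal (w := Sum.inl y) rfl).1

theorem causal_inr_inr (x y : X₂) :
    (S₁.amalgamation S₂ f).causal (inr f x) (inr f y) ↔ S₂.causal x y := by
  refine ⟨?_, fun h => quotient_causal_mk (S := S₁.disjUnion S₂) (Sum.LiftRel.inr h)⟩
  rintro ⟨n, p, q, h, hcausal⟩
  exact (chain_from_inr h₁ h₂ hf hτ hc h hcausal (w := Sum.inr y) rfl).1

theorem tau_inl_inl (x y : X₁) :
    (S₁.amalgamation S₂ f).tau (inl f x) (inl f y) = S₁.tau x y := by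
  refine le_antisymm (iSup_le fun n => iSup_le fun p => iSup_le fun q => iSup_le fun h =>
    (chain_from_inl h₁ h₂ hf hτ hc h.1 h.2 (w := Sum.inl y) rfl).2) ?_
  by_cases hxy : S₁.causal x y
  · exact le_quotient_tau_mk (S := S₁.disjUnion S₂) (a := Sum.inl x) (b := Sum.inl y)
      (Sum.LiftRel.inl hxy)
  · rw [h₁.tau_eq_zero hxy]
    exact zero_le

theorem tau_inr_inr (x y : X₂) :
    (S₁.amalgamation S₂ f).tau (inr f x) (inr f y) = S₂.tau x y := by
  refine le_antisymm (iSup_le fun n => iSup_le fun p => iSup_le fun q => iSup_le fun h =>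
    (chain_from_inr h₁ h₂ hf hτ hc h.1 h.2 (w := Sum.inr y) rfl).2) ?_
  by_cases hxy : S₂.causal x y
  · exact le_quotient_tau_mk (S := S₁.disjUnion S₂) (a := Sum.inr x) (b := Sum.inr y)
      (Sum.LiftRel.inr hxy)
  · rw [h₂.tau_eq_zero hxy]
    exact zero_le

omit hf hτ hc in
theorem isAlgebraic : (S₁.amalgamation S₂ f).IsAlgebraic :=
  quotient_isAlgebraic fun x => by
    rcases x with x | x
    exacts [Sum.LiftRel.inl (h₁.causal_refl x), Sum.LiftRel.inr (h₂.causal_refl x)]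

theorem exists_between_inl_inr {x : X₁} {y : X₂}
    (h : (S₁.amalgamation S₂ f).causal (inl f x) (inr f y)) :
    ∃ a : A₁, S₁.causal x a ∧ S₂.causal (f a) y := by
  obtain ⟨n, p, q, h, hcausal⟩ := h
  obtain ⟨a, hxa, hay, -⟩ := chain_from_inl h₁ h₂ hf hτ hc h hcausal (w := Sum.inr y) rfl
  exact ⟨a, hxa, hay⟩

theorem exists_between_inr_inl {x : X₂} {y : X₁}
    (h : (S₁.amalgamation S₂ f).causal (inr f x) (inl f y)) :
    ∃ a : A₁, S₂.causal x (f a) ∧ S₁.causal a y := by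
  obtain ⟨n, p, q, h, hcausal⟩ := h
  obtain ⟨a, hxa, hay, -⟩ := chain_from_inr h₁ h₂ hf hτ hc h hcausal (w := Sum.inl y) rfl
  exact ⟨a, hxa, hay⟩

theorem exists_tau_between_inl_inr {x : X₁} {y : X₂} {c : ℝ≥0∞}
    (h : c < (S₁.amalgamation S₂ f).tau (inl f x) (inr f y)) :
    ∃ a : A₁, S₁.causal x a ∧ S₂.causal (f a) y ∧ c < S₁.tau x a + S₂.tau (f a) y := by
  obtain ⟨n, p, q, h, hcausal, hlt⟩ := exists_chain_of_lt_tau h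
  obtain ⟨a, hxa, hay, hle⟩ := chain_from_inl h₁ h₂ hf hτ hc h hcausal (w := Sum.inr y) rfl
  exact ⟨a, hxa, hay, hlt.trans_le hle⟩

theorem exists_tau_between_inr_inl {x : X₂} {y : X₁} {c : ℝ≥0∞}
    (h : c < (S₁.amalgamation S₂ f).tau (inr f x) (inl f y)) :
    ∃ a : A₁, S₂.causal x (f a) ∧ S₁.causal a y ∧ c < S₂.tau x (f a) + S₁.tau a y := by
  obtain ⟨n, p, q, h, hcausal, hlt⟩ := exists_chain_of_lt_tau h
  obtain ⟨a, hxa, hay, hle⟩ := chain_from_inr h₁ h₂ hf hτ hc h hcausal (w := Sum.inl y) rfl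
  exact ⟨a, hxa, hay, hlt.trans_le hle⟩

end Causal

/-! ### The amalgamation as a space glued from two pieces -/

/-- The two pieces of the amalgamation. -/
def piece (f : A₁ → A₂) (k : Bool) : Set (Amalgamation f) :=
  cond k (Set.range (inl f)) (Set.range (inr f))

variable [PseudoEMetricSpace X₁] [PseudoEMetricSpace X₂] {f : A₁ ≃ₜ A₂}

theorem isPieceEmbedding_inl (h₁ : S₁.IsAlgebraic) (h₂ : S₂.IsAlgebraic)
    (hf : IsLorentzianGluing S₁ S₂ f) :
    S₁.IsPieceEmbedding (S₁.amalgamation S₂ f) (inl f) where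
  lipschitzWith := lipschitzWith_inl f
  isEmbedding := isEmbedding_inl hf.isClosed_left hf.isClosed_right hf.locallyBiLipschitz
  causal_iff := causal_inl_inl h₁ h₂ f.injective hf.tau_eq hf.causal_iff
  chron_iff x y := by
    rw [← h₁.tau_pos_iff, ← tau_inl_inl h₁ h₂ f.injective hf.tau_eq hf.causal_iff]
    rfl
  tau_eq := tau_inl_inl h₁ h₂ f.injective hf.tau_eq hf.causal_iff

theorem isPieceEmbedding_inr (h₁ : S₁.IsAlgebraic) (h₂ : S₂.IsAlgebraic)
    (hf : IsLorentzianGluing S₁ S₂ f) :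
    S₂.IsPieceEmbedding (S₁.amalgamation S₂ f) (inr f) where
  lipschitzWith := lipschitzWith_inr f
  isEmbedding := isEmbedding_inr hf.isClosed_left hf.isClosed_right hf.locallyBiLipschitz
  causal_iff := causal_inr_inr h₁ h₂ f.injective hf.tau_eq hf.causal_iff
  chron_iff x y := by
    rw [← h₂.tau_pos_iff, ← tau_inr_inr h₁ h₂ f.injective hf.tau_eq hf.causal_iff]
    rfl
  tau_eq := tau_inr_inr h₁ h₂ f.injective hf.tau_eq hf.causal_iff

/-- Points of the amalgamation are isolated neither from the future nor from the past within the
pieces that contain them. -/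
theorem exists_related_mem {R : Amalgamation f → Amalgamation f → Prop} {R₁ : X₁ → X₁ → Prop}
    {R₂ : X₂ → X₂ → Prop} (hR₁ : ∀ x y, R₁ x y → R (inl f x) (inl f y))
    (hR₂ : ∀ x y, R₂ x y → R (inr f x) (inr f y))
    (hA : ∀ a ∈ A₁, ∀ U ∈ 𝓝 a, ∃ b ∈ U ∩ A₁, R₁ a b) (h₁ : ∀ x, ∀ U ∈ 𝓝 x, ∃ b ∈ U, R₁ x b)
    (h₂ : ∀ x, ∀ U ∈ 𝓝 x, ∃ b ∈ U, R₂ x b) (y : Amalgamation f) (U : Set (Amalgamation f))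
    (hU : U ∈ 𝓝 y) : ∃ b ∈ U, R y b ∧ ∀ k, y ∈ piece f k → b ∈ piece f k := by
  by_cases hy : ∃ a : A₁, inl f (a : X₁) = y
  · obtain ⟨a, rfl⟩ := hy
    obtain ⟨b, ⟨hbU, hbA⟩, hab⟩ := hA a a.2 _ ((lipschitzWith_inl f).continuous.continuousAt hU)
    refine ⟨inl f b, hbU, hR₁ _ _ hab, ?_⟩
    rintro (_ | _) -
    · exact ⟨_, (inl_eq_inr f ⟨b, hbA⟩).symm⟩
    · exact ⟨b, rfl⟩
  -- Off the gluing set `y` lies in one piece only, so any nearby related point of that space will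
  -- do.
  rcases exists_rep f y with ⟨x, rfl⟩ | ⟨x, rfl⟩
  · obtain ⟨b, hbU, hab⟩ := h₁ x _ ((lipschitzWith_inl f).continuous.continuousAt hU)
    refine ⟨inl f b, hbU, hR₁ _ _ hab, ?_⟩
    rintro (_ | _) hk
    · obtain ⟨x', hx'⟩ := hk
      obtain ⟨a, rfl, -⟩ := exists_of_inl_eq_inr f.injective hx'.symm
      exact absurd ⟨a, rfl⟩ hy
    · exact ⟨b, rfl⟩
  · obtain ⟨b, hbU, hab⟩ := h₂ x _ ((lipschitzWith_inr f).continuous.continuousAt hU)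
    refine ⟨inr f b, hbU, hR₂ _ _ hab, ?_⟩
    rintro (_ | _) hk
    · exact ⟨b, rfl⟩
    · obtain ⟨x', hx'⟩ := hk
      obtain ⟨a, rfl, -⟩ := exists_of_inl_eq_inr f.injective hx'
      exact absurd ⟨a, hx'⟩ hy

theorem isGluedFrom (hX₁ : S₁.IsLengthSpace) (hX₂ : S₂.IsLengthSpace)
    (hsc₁ : S₁.StronglyCausal) (hsc₂ : S₂.StronglyCausal)
    [LocallyCompactSpace X₁] [LocallyCompactSpace X₂] (hf : IsLorentzianGluing S₁ S₂ f) :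
    (S₁.amalgamation S₂ f).IsGluedFrom (piece f) := by
  have h₁ := hX₁.toIsPreLengthSpace.isAlgebraic
  have h₂ := hX₂.toIsPreLengthSpace.isAlgebraic
  have hT := isAlgebraic (f := f) h₁ h₂
  have i₁ := isPieceEmbedding_inl h₁ h₂ hf
  have i₂ := isPieceEmbedding_inr h₁ h₂ hf
  have hcl₁ := isClosed_range_inl hf.isClosed_left hf.isClosed_right hf.locallyBiLipschitz
  have hcl₂ := isClosed_range_inr hf.isClosed_left hf.isClosed_right hf.locallyBiLipschitz
  have mem₁ : ∀ a : A₁, inr f (f a : X₂) ∈ Set.range (inl f : X₁ → Amalgamation f) :=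
    fun a => ⟨_, inl_eq_inr f a⟩
  have mem₂ : ∀ a : A₁, inl f (a : X₁) ∈ Set.range (inr f : X₂ → Amalgamation f) :=
    fun a => ⟨_, (inl_eq_inr f a).symm⟩
  refine ⟨hT, eq_of_edist_eq_zero hf.isClosed_left hf.isClosed_right hf.locallyBiLipschitz
    hX₁.eq_of_edist_eq_zero hX₂.eq_of_edist_eq_zero, ?_, ?_, ?_, ?_, ?_, ?_, ?_, ?_, ?_, ?_, ?_, ?_,
    ?_⟩
  · rintro (_ | _)
    exacts [hcl₂, hcl₁]
  · intro y
    rcases exists_rep f y with h | h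
    exacts [⟨true, h⟩, ⟨false, h⟩]
  · refine exists_related_mem (R₁ := S₁.chron) (R₂ := S₂.chron) (fun x y => (i₁.chron_iff x y).2)
      (fun x y => (i₂.chron_iff x y).2) (fun a ha U hU => ?_) hX₁.exists_future hX₂.exists_future
    -- In a length space every point has a nonempty timelike future, so the non-isolation hypothesis
    -- applies at every point of `A₁`.
    obtain ⟨b, -, hb⟩ := hX₁.exists_future a U hU
    exact hf.nonTimelikeLocallyIsolating_left.1 a ha ⟨b, hb⟩ U hU
  · refine exists_related_mem (R := fun a b => (S₁.amalgamation S₂ f).chron b a)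
      (R₁ := fun a b => S₁.chron b a) (R₂ := fun a b => S₂.chron b a)
      (fun x y => (i₁.chron_iff y x).2)
      (fun x y => (i₂.chron_iff y x).2) (fun a ha U hU => ?_) hX₁.exists_past hX₂.exists_past
    obtain ⟨b, -, hb⟩ := hX₁.exists_past a U hU
    exact hf.nonTimelikeLocallyIsolating_left.2 a ha ⟨b, hb⟩ U hU
  · rintro (_ | _) (_ | _) x hx y hy hxy
    · exact ⟨x, hx, hx, hT.causal_refl x, hxy⟩
    · obtain ⟨x, rfl⟩ := hx
      obtain ⟨y, rfl⟩ := hy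
      obtain ⟨a, hxa, hay⟩ :=
        exists_between_inr_inl h₁ h₂ f.injective hf.tau_eq hf.causal_iff hxy
      refine ⟨inl f a, mem₂ a, ⟨_, rfl⟩, ?_, (i₁.causal_iff _ _).2 hay⟩
      rw [inl_eq_inr]
      exact (i₂.causal_iff _ _).2 hxa
    · obtain ⟨x, rfl⟩ := hx
      obtain ⟨y, rfl⟩ := hy
      obtain ⟨a, hxa, hay⟩ :=
        exists_between_inl_inr h₁ h₂ f.injective hf.tau_eq hf.causal_iff hxy
      refine ⟨inl f a, ⟨_, rfl⟩, mem₂ a, (i₁.causal_iff _ _).2 hxa, ?_⟩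
      rw [inl_eq_inr]
      exact (i₂.causal_iff _ _).2 hay
    · exact ⟨x, hx, hx, hT.causal_refl x, hxy⟩
  · rintro (_ | _) (_ | _) x hx y hy c hxy
    · exact ⟨x, hx, hx, hT.causal_refl x, hT.causal_of_tau_pos (pos_of_gt hxy),
        hxy.trans_le le_add_self⟩
    · obtain ⟨x, rfl⟩ := hx
      obtain ⟨y, rfl⟩ := hy
      obtain ⟨a, hxa, hay, hlt⟩ :=
        exists_tau_between_inr_inl h₁ h₂ f.injective hf.tau_eq hf.causal_iff hxy
      refine ⟨inr f (f a), ⟨_, rfl⟩, mem₁ a, (i₂.causal_iff _ _).2 hxa, ?_, ?_⟩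
      · rw [← inl_eq_inr]
        exact (i₁.causal_iff _ _).2 hay
      · rwa [i₂.tau_eq, ← inl_eq_inr, i₁.tau_eq]
    · obtain ⟨x, rfl⟩ := hx
      obtain ⟨y, rfl⟩ := hy
      obtain ⟨a, hxa, hay, hlt⟩ :=
        exists_tau_between_inl_inr h₁ h₂ f.injective hf.tau_eq hf.causal_iff hxy
      refine ⟨inl f a, ⟨_, rfl⟩, mem₂ a, (i₁.causal_iff _ _).2 hxa, ?_, ?_⟩
      · rw [inl_eq_inr]
        exact (i₂.causal_iff _ _).2 hay
      · rwa [i₁.tau_eq, inl_eq_inr, i₂.tau_eq]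
    · exact ⟨x, hx, hx, hT.causal_refl x, hT.causal_of_tau_pos (pos_of_gt hxy),
        hxy.trans_le le_add_self⟩
  · rintro (_ | _)
    exacts [i₂.lsc_left hX₂.toIsPreLengthSpace, i₁.lsc_left hX₁.toIsPreLengthSpace]
  · rintro (_ | _)
    exacts [i₂.lsc_right hX₂.toIsPreLengthSpace, i₁.lsc_right hX₁.toIsPreLengthSpace]
  · rintro (_ | _)
    exacts [i₂.exists_diamond hX₂ hsc₂, i₁.exists_diamond hX₁ hsc₁]
  · rintro (_ | _)
    exacts [i₂.exists_patch hX₂ hsc₂ hcl₂, i₁.exists_patch hX₁ hsc₁ hcl₁]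
  · rintro (_ | _)
    exacts [i₂.exists_timelike hX₂, i₁.exists_timelike hX₁]
  · rintro (_ | _)
    exacts [i₂.exists_causal hX₂, i₁.exists_causal hX₁]
  · rintro (_ | _)
    exacts [i₂.exists_length_gt hX₂, i₁.exists_length_gt hX₁]

end Amalgamation

theorem mainTheorem2 {X₁ X₂ : Type*} [PseudoEMetricSpace X₁] [PseudoEMetricSpace X₂]
    (S₁ : LorentzianStructure X₁) (S₂ : LorentzianStructure X₂)
    (hX₁ : S₁.IsLengthSpace) (hX₂ : S₂.IsLengthSpace)
    (hsc₁ : S₁.StronglyCausal) (hsc₂ : S₂.StronglyCausal)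
    (hlc₁ : LocallyCompactSpace X₁) (hlc₂ : LocallyCompactSpace X₂)
    {A₁ : Set X₁} {A₂ : Set X₂} (f : A₁ ≃ₜ A₂) (hf : IsLorentzianGluing S₁ S₂ f) :
    (S₁.amalgamation S₂ f).IsLengthSpace ∧ (S₁.amalgamation S₂ f).StronglyLocalizable := by
  have h := Amalgamation.isGluedFrom hX₁ hX₂ hsc₁ hsc₂ hf
  exact ⟨h.isLengthSpace, h.stronglyLocalizable⟩
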